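/- Let $n\ge 0$ and $r\ge 0$ be integers and let $S\in\mathbb{R}^{n\times n}$ be a symmetric matrix with signature $(s_+,s_-,s_0)$, that is, $s_+$, $s_-$ and $s_0$ are the numbers of positive, negative and zero eigenvalues of $S$, counted with multiplicity. Let $$\tau_r^{-1}(S)=\{(\alpha,W)\in\mathbb{R}^r\times\mathbb{R}^{r\times n} : W^{T}\operatorname{diag}(\alpha)\,W=S\},$$ with the subspace topology. Then: 1. if $\operatorname{rk}(S)>r$, then $\tau_r^{-1}(S)$ is empty; 2. if $\operatorname{rk}(S)=r\ge 1$ and $s_+=0$ or $s_-=0$, then $\tau_r^{-1}(S)$ has exactly $2$ connected components; 3. if $\operatorname{rk}(S)=r$, $s_+>0$ and $s_->0$, then $\tau_r^{-1}(S)$ has exactly $4\binom{r}{s_+}=4\binom{r}{s_-}$ connected components; 4. if $\operatorname{rk}(S)<r$, then $\tau_r^{-1}(S)$ is (nonempty and) connected. -/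

import Mathlib

/-- The real symmetric `n × n` matrix `S` has signature `(sp, sm, s0)`: the associated quadratic
form `x ↦ xᵀ S x` has positive index of inertia `sp`, negative index of inertia `sm`, and its
radical has dimension `s0`. For symmetric `S` these are the numbers of positive, negative and zero
eigenvalues of `S`, counted with multiplicity. -/
def HasSignature {n : ℕ} (S : Matrix (Fin n) (Fin n) ℝ) (sp sm s0 : ℕ) : Prop :=
  sigPos S.toQuadraticForm' = sp ∧
  sigNeg S.toQuadraticForm' = sm ∧
  Module.finrank ℝ S.toQuadraticForm'.radical = s0

/-- The parameterization map of a width-`r` quadratic network, `(α, W) ↦ Wᵀ diag(α) W`. -/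
def quadTau (r n : ℕ) (p : (Fin r → ℝ) × Matrix (Fin r) (Fin n) ℝ) :
    Matrix (Fin n) (Fin n) ℝ :=
  p.2.transpose * Matrix.diagonal p.1 * p.2

/-- The fiber `{(α, W) : Wᵀ diag(α) W = S}` in `ℝ^r × ℝ^(r × n)`. -/
def quadFiber (r : ℕ) {n : ℕ} (S : Matrix (Fin n) (Fin n) ℝ) :
    Set ((Fin r → ℝ) × Matrix (Fin r) (Fin n) ℝ) :=
  {p | quadTau r n p = S}

/-! ### Plane rotations in the identity component of a pseudo-orthogonal group -/

section Connectivity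

open Matrix

variable {ι κ μ : Type*} [Fintype ι] [DecidableEq ι]

/-! Sylvester's law writes `S = W₀ᵀ diag(J) W₀` with `J` valued in ±1, `rk S` rows in `W₀`, and `W₀`
right invertible. Rescaling rows against weights joins every point of the fiber to one with weights
`σ` in ±1. If its matrix `W` also kills `ker S`, then `W = V W₀` with `Vᵀ diag(σ) V = diag(J)`. The
identity component of the group preserving `σ` acts on such `V`, and circular and hyperbolic
rotations in coordinate planes already bring `V` to a signed monomial matrix
(`exists_inIdComponent_mul_eq_monomialMatrix`).

If `rk S < r`, rows can be shrunk to zero until `W` kills `ker S` (`exists_joinedIn_ker_le`). A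
spare row then lets the others change place and sign freely, so all normal forms are joined
(`joinedIn_of_card_lt`).

If `rk S = r`, `W` kills `ker S` automatically and no weight vanishes on the fiber, so the sign
pattern of `α` is constant on components; there are `r.choose s₊` patterns. For a fixed pattern,
rotations remove all signs of the monomial matrix except one for each value taken by `J`. Each
surviving sign is detected by a determinant, that of `mixedBlock`, which does not vanish along a
connected set. This leaves a factor 2 in the definite case and 4 in the indefinite one. If `rk S >
r`, `S` cannot factor through `ℝ^r`. -/

/-- The pairs `(α, W)` with `Wᵀ diag(α) W = S`, for arbitrary index types. -/
def congrFiber (ι : Type*) [Fintype ι] [DecidableEq ι] (S : Matrix μ μ ℝ) :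
    Set ((ι → ℝ) × Matrix ι μ ℝ) :=
  {p | p.2ᵀ * diagonal p.1 * p.2 = S}

/-- The matrices preserving the diagonal form with weights `σ`. -/
def pseudoOrthogonal (σ : ι → ℝ) : Set (Matrix ι ι ℝ) :=
  {g | gᵀ * diagonal σ * g = diagonal σ}

/-- `g` lies in the identity path component of the pseudo-orthogonal group of `σ`. -/
def InIdComponent (σ : ι → ℝ) (g : Matrix ι ι ℝ) : Prop :=
  JoinedIn (pseudoOrthogonal σ) 1 g

lemma transpose_mul_diagonal_mul_apply (α : ι → ℝ) (V : Matrix ι μ ℝ) (W : Matrix ι κ ℝ) (c d) :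
    (Vᵀ * diagonal α * W) c d = ∑ l, α l * (V l c * W l d) := by
  rw [Matrix.mul_apply]
  refine Finset.sum_congr rfl fun l _ => ?_
  rw [mul_diagonal, transpose_apply]
  ring

lemma mem_congrFiber_iff {S : Matrix μ μ ℝ} {p : (ι → ℝ) × Matrix ι μ ℝ} :
    p ∈ congrFiber ι S ↔ ∀ c d, ∑ l, p.1 l * (p.2 l c * p.2 l d) = S c d := by
  rw [congrFiber, Set.mem_ofPred_eq, ← Matrix.ext_iff]
  simp only [transpose_mul_diagonal_mul_apply]

lemma pseudoOrthogonal_mul {σ : ι → ℝ} {g h : Matrix ι ι ℝ} (hg : g ∈ pseudoOrthogonal σ)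
    (hh : h ∈ pseudoOrthogonal σ) : g * h ∈ pseudoOrthogonal σ := by
  simp only [pseudoOrthogonal, Set.mem_ofPred_eq] at *
  rw [transpose_mul, show hᵀ * gᵀ * diagonal σ * (g * h) = hᵀ * (gᵀ * diagonal σ * g) * h by
    simp only [Matrix.mul_assoc], hg, hh]

lemma mul_mem_congrFiber {S : Matrix μ μ ℝ} {σ : ι → ℝ} {g : Matrix ι ι ℝ} {W : Matrix ι μ ℝ}
    (hg : g ∈ pseudoOrthogonal σ) (hW : (σ, W) ∈ congrFiber ι S) :
    (σ, g * W) ∈ congrFiber ι S := by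
  simp only [pseudoOrthogonal, congrFiber, Set.mem_ofPred_eq] at *
  rw [transpose_mul, show Wᵀ * gᵀ * diagonal σ * (g * W) = Wᵀ * (gᵀ * diagonal σ * g) * W by
    simp only [Matrix.mul_assoc], hg, hW]

lemma InIdComponent.mem {σ : ι → ℝ} {g : Matrix ι ι ℝ} (hg : InIdComponent σ g) :
    g ∈ pseudoOrthogonal σ := JoinedIn.target_mem hg

lemma InIdComponent.one (σ : ι → ℝ) : InIdComponent σ 1 :=
  JoinedIn.refl (by simp [pseudoOrthogonal])

lemma InIdComponent.mul {σ : ι → ℝ} {g h : Matrix ι ι ℝ} (hg : InIdComponent σ g)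
    (hh : InIdComponent σ h) : InIdComponent σ (g * h) := by
  have := JoinedIn.map hg (f := fun x => x * h) (by fun_prop)
  rw [Matrix.one_mul] at this
  refine JoinedIn.trans hh (this.mono ?_)
  rintro _ ⟨x, hx, rfl⟩
  exact pseudoOrthogonal_mul hx hh.mem

lemma InIdComponent.joinedIn {S : Matrix μ μ ℝ} {σ : ι → ℝ} {g : Matrix ι ι ℝ}
    {W : Matrix ι μ ℝ} (hg : InIdComponent σ g) (hW : (σ, W) ∈ congrFiber ι S) :
    JoinedIn (congrFiber ι S) (σ, W) (σ, g * W) := by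
  have := JoinedIn.map hg (f := fun x => (σ, x * W)) (by fun_prop)
  rw [Matrix.one_mul] at this
  refine this.mono ?_
  rintro _ ⟨x, hx, rfl⟩
  exact mul_mem_congrFiber hx hW

lemma InIdComponent.of_curve {σ : ι → ℝ} {φ : ℝ → Matrix ι ι ℝ} (hφ : Continuous φ)
    (h0 : φ 0 = 1) (h : ∀ t, φ t ∈ pseudoOrthogonal σ) (θ : ℝ) : InIdComponent σ (φ θ) := by
  refine JoinedIn.ofLine (f := fun t => φ (t * θ)) (by fun_prop) (by simp [h0]) (by simp) ?_
  rintro _ ⟨t, -, rfl⟩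
  exact h _

/-- The matrix acting by `!![a, b; c, d]` on the coordinates `i, j` and trivially elsewhere. -/
def planeMatrix (i j : ι) (a b c d : ℝ) : Matrix ι ι ℝ := fun l m =>
  if l = i then (if m = i then a else if m = j then b else 0)
  else if l = j then (if m = i then c else if m = j then d else 0)
  else if l = m then 1 else 0

lemma planeMatrix_mulVec {i j : ι} (hij : i ≠ j) (a b c d : ℝ) (v : ι → ℝ) (l : ι) :
    (planeMatrix i j a b c d *ᵥ v) l =
      if l = i then a * v i + b * v j else if l = j then c * v i + d * v j else v l := by
  have key (x y : ℝ) : ∑ m, (if m = i then x else if m = j then y else 0) * v m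
      = x * v i + y * v j := by
    rw [Finset.sum_eq_add i j hij (fun m _ hm => by simp [hm.1, hm.2]) (by simp) (by simp)]
    simp [hij.symm]
  simp only [mulVec, dotProduct, planeMatrix]
  split_ifs
  · exact key a b
  · exact key c d
  · simp

/-- The hypotheses say that the 2×2 block preserves `σ i x² + σ j y²`. Comparing with the identity
matrix cancels every row other than `i` and `j`. -/
lemma planeMatrix_mem {σ : ι → ℝ} {i j : ι} (hij : i ≠ j) {a b c d : ℝ}
    (h1 : σ i * a ^ 2 + σ j * c ^ 2 = σ i) (h2 : σ i * (a * b) + σ j * (c * d) = 0)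
    (h3 : σ i * b ^ 2 + σ j * d ^ 2 = σ j) :
    planeMatrix i j a b c d ∈ pseudoOrthogonal σ := by
  have h : (planeMatrix i j a b c d)ᵀ * diagonal σ * planeMatrix i j a b c d =
      (1 : Matrix ι ι ℝ)ᵀ * diagonal σ * 1 := by
    ext x y
    rw [transpose_mul_diagonal_mul_apply, transpose_mul_diagonal_mul_apply, ← sub_eq_zero,
      ← Finset.sum_sub_distrib, Finset.sum_eq_add i j hij ?_ (by simp) (by simp)]
    · have hji := hij.symm
      simp only [planeMatrix, Matrix.one_apply, if_true, if_neg hji]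
      simp only [@eq_comm _ i x, @eq_comm _ i y, @eq_comm _ j x, @eq_comm _ j y]
      by_cases hxi : x = i
      · by_cases hyi : y = i
        · simp only [hxi, hyi, if_true, if_neg hij]; linarith
        · by_cases hyj : y = j
          · simp only [hxi, hyj, if_true, if_neg hij, if_neg hji]; linarith
          · simp [hxi, hyi, hyj]
      · by_cases hxj : x = j
        · by_cases hyi : y = i
          · simp only [hxj, hyi, if_true, if_neg hij, if_neg hji]; linarith
          · by_cases hyj : y = j
            · simp only [hxj, hyj, if_true, if_neg hji]; linarith
            · simp [hxj, hyi, hyj]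
        · simp [hxi, hxj]
    · intro l _ hl
      simp [planeMatrix, hl.1, hl.2, Matrix.one_apply]
  simpa [pseudoOrthogonal] using h

omit [Fintype ι] in
lemma continuous_planeMatrix (i j : ι) {a b c d : ℝ → ℝ} (ha : Continuous a) (hb : Continuous b)
    (hc : Continuous c) (hd : Continuous d) :
    Continuous fun t => planeMatrix i j (a t) (b t) (c t) (d t) := by
  refine continuous_matrix fun l m => ?_
  simp only [planeMatrix]
  split_ifs <;> fun_prop

omit [Fintype ι] in
lemma planeMatrix_one (i j : ι) (hij : i ≠ j) : planeMatrix i j 1 0 0 1 = 1 := by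
  ext l m
  simp only [planeMatrix, Matrix.one_apply]
  split_ifs <;> simp_all

lemma inIdComponent_rotation {σ : ι → ℝ} {i j : ι} (hij : i ≠ j) (h : σ i = σ j) (θ : ℝ) :
    InIdComponent σ (planeMatrix i j (Real.cos θ) (-Real.sin θ) (Real.sin θ) (Real.cos θ)) := by
  refine InIdComponent.of_curve (φ := fun θ =>
    planeMatrix i j (Real.cos θ) (-Real.sin θ) (Real.sin θ) (Real.cos θ))
    (continuous_planeMatrix i j (by fun_prop) (by fun_prop) (by fun_prop) (by fun_prop))
    (by simpa using planeMatrix_one i j hij) (fun t => planeMatrix_mem hij ?_ ?_ ?_) θ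
  · rw [h]; linear_combination σ j * Real.sin_sq_add_cos_sq t
  · rw [h]; ring
  · rw [h]; linear_combination σ j * Real.sin_sq_add_cos_sq t

lemma inIdComponent_hyperbolic {σ : ι → ℝ} {i j : ι} (hij : i ≠ j) (h : σ i = -σ j) (θ : ℝ) :
    InIdComponent σ
      (planeMatrix i j (Real.cosh θ) (Real.sinh θ) (Real.sinh θ) (Real.cosh θ)) := by
  refine InIdComponent.of_curve (φ := fun θ =>
    planeMatrix i j (Real.cosh θ) (Real.sinh θ) (Real.sinh θ) (Real.cosh θ))
    (continuous_planeMatrix i j Real.continuous_cosh Real.continuous_sinh Real.continuous_sinh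
      Real.continuous_cosh)
    (by simpa using planeMatrix_one i j hij) (fun t => planeMatrix_mem hij ?_ ?_ ?_) θ
  · rw [h]; linear_combination (-σ j) * Real.cosh_sq t
  · rw [h]; ring
  · rw [h]; linear_combination (σ j) * Real.cosh_sq t

/-- The equation reads `tanh θ = -y / x`, solvable because `|y / x| < 1`. -/
lemma exists_sinh_mul_add_cosh_mul_eq_zero {x y : ℝ} (h : y ^ 2 < x ^ 2) :
    ∃ θ, Real.sinh θ * x + Real.cosh θ * y = 0 := by
  have hx : x ≠ 0 := by rintro rfl; nlinarith [sq_nonneg y]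
  have hlt : |y| < |x| := sq_lt_sq.mp h
  have hm : -y / x ∈ Set.Ioo (-1 : ℝ) 1 := by
    rw [Set.mem_Ioo, ← abs_lt, abs_div, abs_neg, div_lt_one (abs_pos.mpr hx)]
    exact hlt
  refine ⟨Real.artanh (-y / x), ?_⟩
  have := Real.tanh_artanh hm
  rw [Real.tanh_eq_sinh_div_cosh, div_eq_div_iff (Real.cosh_pos _).ne' hx] at this
  linarith

/-- With equal weights a rotation kills the second coordinate; with opposite weights a boost kills
the one of smaller absolute value. Only the light cone, excluded by `hne`, is out of reach. -/
lemma exists_planeMatrix_annihilate {σ : ι → ℝ} (hσ : ∀ l, σ l = 1 ∨ σ l = -1) {i j : ι}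
    (hij : i ≠ j) {x y : ℝ} (hx : x ≠ 0) (hne : σ i * x ^ 2 + σ j * y ^ 2 ≠ 0) :
    ∃ a b c d, InIdComponent σ (planeMatrix i j a b c d) ∧
      (a * x + b * y = 0 ∨ c * x + d * y = 0) := by
  by_cases h : σ i = σ j
  · refine ⟨_, _, _, _, inIdComponent_rotation hij h (Real.arctan (-y / x)), Or.inr ?_⟩
    have hc := (Real.cos_arctan_pos (-y / x)).ne'
    have ht := Real.tan_arctan (-y / x)
    rw [Real.tan_eq_sin_div_cos, div_eq_div_iff hc hx] at ht
    linarith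
  · have h' : σ i = -σ j := by
      rcases hσ i with h1 | h1 <;> rcases hσ j with h2 | h2 <;> simp_all
    have hxy : x ^ 2 ≠ y ^ 2 := fun e => hne (by rw [h', e]; ring)
    rcases lt_or_gt_of_ne hxy with hlt | hlt
    · obtain ⟨θ, hθ⟩ := exists_sinh_mul_add_cosh_mul_eq_zero hlt
      exact ⟨_, _, _, _, inIdComponent_hyperbolic hij h' θ, Or.inl (by linarith)⟩
    · obtain ⟨θ, hθ⟩ := exists_sinh_mul_add_cosh_mul_eq_zero hlt
      exact ⟨_, _, _, _, inIdComponent_hyperbolic hij h' θ, Or.inr hθ⟩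

/-- Every vector can be moved by the identity component so that the contributions of any two of
its nonzero coordinates to the quadratic form cancel. -/
lemma exists_inIdComponent_pairwise_null {σ : ι → ℝ} (hσ : ∀ l, σ l = 1 ∨ σ l = -1)
    (v : ι → ℝ) : ∃ g, InIdComponent σ g ∧ (∀ l, v l = 0 → ∀ x : ι → ℝ, (g *ᵥ x) l = x l) ∧
      (∀ x : ι → ℝ, (∀ l, v l ≠ 0 → x l = 0) → g *ᵥ x = x) ∧
      ∀ i j, i ≠ j → (g *ᵥ v) i ≠ 0 → (g *ᵥ v) j ≠ 0 →
        σ i * (g *ᵥ v) i ^ 2 + σ j * (g *ᵥ v) j ^ 2 = 0 := by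
  induction hn : (Finset.univ.filter fun l => v l ≠ 0).card using Nat.strong_induction_on
    generalizing v with
  | _ n ih =>
    by_cases hv : ∀ i j, i ≠ j → v i ≠ 0 → v j ≠ 0 → σ i * v i ^ 2 + σ j * v j ^ 2 = 0
    · exact ⟨1, .one σ, by simp, by simp, by simpa using hv⟩
    push Not at hv
    obtain ⟨i, j, hij, hi, hj, hne⟩ := hv
    -- Killing one coordinate of a pair that does not cancel strictly shrinks the support, which
    -- drives the induction.
    obtain ⟨a, b, c, d, hg, h0⟩ := exists_planeMatrix_annihilate hσ hij hi hne
    set p := planeMatrix i j a b c d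
    have hp (x : ι → ℝ) (l : ι) : (p *ᵥ x) l =
        if l = i then a * x i + b * x j else if l = j then c * x i + d * x j else x l :=
      planeMatrix_mulVec hij a b c d x l
    have hfix (l : ι) (hl : v l = 0) (x : ι → ℝ) : (p *ᵥ x) l = x l := by
      rw [hp, if_neg (by rintro rfl; exact hi hl), if_neg (by rintro rfl; exact hj hl)]
    have hzero (l : ι) (hl : v l = 0) : (p *ᵥ v) l = 0 := by rw [hfix l hl, hl]
    have hlt : (Finset.univ.filter fun l => (p *ᵥ v) l ≠ 0).card < n := by
      rw [← hn]
      refine Finset.card_lt_card (Finset.ssubset_iff_of_subset ?_ |>.mpr ?_)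
      · intro l
        simp only [Finset.mem_filter, Finset.mem_univ, true_and]
        exact fun h h' => h (hzero l h')
      · rcases h0 with h0 | h0
        · exact ⟨i, by simpa using hi, by simp [hp, h0]⟩
        · exact ⟨j, by simpa using hj, by simp [hp, h0, hij.symm]⟩
    obtain ⟨g, hg', hr, hc, ht⟩ := ih _ hlt (p *ᵥ v) rfl
    refine ⟨g * p, hg'.mul hg, fun l hl x => ?_, fun x hx => ?_, ?_⟩
    · rw [← mulVec_mulVec, hr l (hzero l hl), hfix l hl]
    · have : p *ᵥ x = x := by
        ext l
        rw [hp, hx i hi, hx j hj]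
        split_ifs with h1 h2
        · rw [h1, hx i hi]; simp
        · rw [h2, hx j hj]; simp
        · rfl
      rw [← mulVec_mulVec, this]
      exact hc x fun l hl => hx l fun h => hl (hzero l h)
    · simpa only [← mulVec_mulVec] using ht

/-- Three nonzero numbers cannot cancel pairwise, and exactly two would give sum zero. -/
lemma eq_zero_of_pairwise_null_of_sum_ne_zero {f : ι → ℝ}
    (hf : ∀ i j, i ≠ j → f i ≠ 0 → f j ≠ 0 → f i + f j = 0) (hs : ∑ l, f l ≠ 0) :
    ∃ i, f i ≠ 0 ∧ ∀ l, l ≠ i → f l = 0 := by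
  obtain ⟨i, -, hi⟩ := Finset.exists_ne_zero_of_sum_ne_zero hs
  refine ⟨i, hi, ?_⟩
  by_contra! h
  obtain ⟨j, hji, hj⟩ := h
  refine hs ?_
  rw [Finset.sum_eq_add j i hji ?_ (by simp) (by simp)]
  · exact hf j i hji hj hi
  · intro l _ hl
    by_contra h
    have h1 := hf l i hl.2 h hi
    have h2 := hf l j hl.1 h hj
    have h3 := hf j i hji hj hi
    exact hi (by linarith)

end Connectivity

/-! ### Signed monomial normal forms -/

section Monomial

open Matrix

variable {ι κ μ : Type*} [Fintype ι] [DecidableEq ι] [DecidableEq κ]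

/-- The matrix whose column `c` is `a c` times the basis vector at `π c`. -/
def monomialMatrix (π : κ → ι) (a : κ → ℝ) : Matrix ι κ ℝ :=
  fun i c => if i = π c then a c else 0

/-- Distinct columns are `σ`-orthogonal, and pairing with a multiple of a basis vector reads off one
entry. -/
lemma apply_eq_zero_of_column_eq {σ : ι → ℝ} {J : κ → ℝ} {V : Matrix ι κ ℝ}
    (hσ : ∀ l, σ l = 1 ∨ σ l = -1) (hV : (σ, V) ∈ congrFiber ι (diagonal J)) {c d : κ}
    (hcd : c ≠ d) {i : ι} {a : ℝ} (ha : a ≠ 0) (hc : ∀ l, V l c = if l = i then a else 0) :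
    V i d = 0 := by
  have h := mem_congrFiber_iff.mp hV c d
  simp only [hc, ite_mul, zero_mul, mul_ite, mul_zero, Finset.sum_ite_eq', Finset.mem_univ,
    if_true, diagonal_apply_ne _ hcd] at h
  rcases hσ i with h1 | h1 <;> simp_all

lemma weight_mul_sq_of_column_eq {σ : ι → ℝ} {J : κ → ℝ} {V : Matrix ι κ ℝ}
    (hV : (σ, V) ∈ congrFiber ι (diagonal J)) {c : κ} {i : ι} {a : ℝ}
    (hc : ∀ l, V l c = if l = i then a else 0) : σ i * a ^ 2 = J c := by
  have h := mem_congrFiber_iff.mp hV c c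
  simp only [hc, ite_mul, zero_mul, mul_ite, mul_zero, Finset.sum_ite_eq', Finset.mem_univ,
    if_true, diagonal_apply_eq] at h
  rw [← h]; ring

/-- Column `c` has norm `J c ≠ 0`, so pairwise cancellation leaves it a single nonzero entry. By
orthogonality it vanishes at the positions of the columns in `s`, and the motion fixes vectors
supported where it vanishes, so earlier work is kept. -/
lemma exists_column_monomial {σ : ι → ℝ} {J : κ → ℝ} {V : Matrix ι κ ℝ}
    (hσ : ∀ l, σ l = 1 ∨ σ l = -1) (hJ : ∀ c, J c = 1 ∨ J c = -1)
    (hV : (σ, V) ∈ congrFiber ι (diagonal J)) {s : Finset κ}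
    (hs : ∀ d ∈ s, ∃ i, ∃ a, a ≠ 0 ∧ ∀ l, V l d = if l = i then a else 0) {c : κ} (hc : c ∉ s) :
    ∃ g i a, InIdComponent σ g ∧ (∀ l, (g * V) l c = if l = i then a else 0) ∧ σ i = J c ∧
      a ^ 2 = 1 ∧ ∀ d ∈ s, ∀ l, (g * V) l d = V l d := by
  obtain ⟨g, hg, -, hfix, hnull⟩ := exists_inIdComponent_pairwise_null hσ fun l => V l c
  have hcol (d l) : (g * V) l d = (g *ᵥ fun l => V l d) l := rfl
  have hgV := mul_mem_congrFiber hg.mem hV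
  have hσ0 (l) : σ l ≠ 0 := by rcases hσ l with h | h <;> simp [h]
  have hsum : ∑ l, σ l * (g * V) l c ^ 2 = J c := by
    have := mem_congrFiber_iff.mp hgV c c
    simpa [pow_two] using this
  obtain ⟨i, hi, hi'⟩ := eq_zero_of_pairwise_null_of_sum_ne_zero
    (f := fun l => σ l * (g * V) l c ^ 2)
    (fun i j hij h1 h2 => hnull i j hij (by rintro h; exact h1 (by simp [hcol, h]))
      (by rintro h; exact h2 (by simp [hcol, h])))
    (by rw [hsum]; rcases hJ c with h | h <;> simp [h])
  have hc' : ∀ l, (g * V) l c = if l = i then (g * V) i c else 0 := by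
    intro l
    split_ifs with h
    · rw [h]
    · simpa [hσ0] using hi' l h
  have hw := weight_mul_sq_of_column_eq hgV hc'
  have hpos : 0 < (g * V) i c ^ 2 := by
    refine lt_of_le_of_ne (sq_nonneg _) fun h => hi ?_
    simp [← h]
  refine ⟨g, i, _, hg, hc', ?_, ?_, ?_⟩
  · rcases hσ i with h1 | h1 <;> rcases hJ c with h2 | h2 <;> rw [h1, h2] at hw <;>
      first | (rw [h1, h2]; done) | linarith
  · rcases hσ i with h1 | h1 <;> rcases hJ c with h2 | h2 <;> rw [h1, h2] at hw <;> linarith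
  · intro d hd l
    obtain ⟨j, b, hb, hd'⟩ := hs d hd
    have hj : V j c = 0 :=
      apply_eq_zero_of_column_eq hσ hV (by rintro rfl; exact hc hd) hb hd'
    rw [hcol, hfix]
    intro l hl
    simp only [hd']
    rw [if_neg]
    rintro rfl
    exact hl hj

/-- Every solution of `Vᵀ diag(σ) V = diag(J)` can be moved to a signed monomial matrix. -/
lemma exists_inIdComponent_mul_eq_monomialMatrix [Fintype κ] {σ : ι → ℝ} {J : κ → ℝ}
    {V : Matrix ι κ ℝ}
    (hσ : ∀ l, σ l = 1 ∨ σ l = -1) (hJ : ∀ c, J c = 1 ∨ J c = -1)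
    (hV : (σ, V) ∈ congrFiber ι (diagonal J)) :
    ∃ g π a, InIdComponent σ g ∧ g * V = monomialMatrix π a ∧ (∀ c, σ (π c) = J c) ∧
      (∀ c, a c ^ 2 = 1) ∧ Function.Injective π := by
  have key (s : Finset κ) : ∃ g, InIdComponent σ g ∧ ∀ c ∈ s, ∃ i a, σ i = J c ∧ a ^ 2 = 1 ∧
      ∀ l, (g * V) l c = if l = i then a else 0 := by
    induction s using Finset.induction_on with
    | empty => exact ⟨1, .one σ, by simp⟩
    | insert c s hc ih =>
      obtain ⟨g, hg, hs⟩ := ih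
      obtain ⟨g', i, a, hg', h1, h2, h3, h4⟩ := exists_column_monomial hσ hJ
        (mul_mem_congrFiber hg.mem hV) (fun d hd => by
          obtain ⟨i, a, -, ha, h⟩ := hs d hd
          exact ⟨i, a, by rintro rfl; simp at ha, h⟩) hc
      refine ⟨g' * g, hg'.mul hg, fun d hd => ?_⟩
      rw [Matrix.mul_assoc]
      rcases Finset.mem_insert.mp hd with rfl | hd
      · exact ⟨i, a, h2, h3, h1⟩
      · obtain ⟨i, a, h5, h6, h7⟩ := hs d hd
        exact ⟨i, a, h5, h6, fun l => by rw [h4 d hd, h7]⟩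
  obtain ⟨g, hg, h⟩ := key Finset.univ
  choose π a h1 h2 h3 using fun c => h c (Finset.mem_univ c)
  refine ⟨g, π, a, hg, by ext l c; exact h3 c l, h1, h2, fun c d hcd => ?_⟩
  by_contra hne
  have hne0 (c) : a c ≠ 0 := fun h => by simpa [h] using h2 c
  have := apply_eq_zero_of_column_eq hσ (mul_mem_congrFiber hg.mem hV) hne (hne0 c) (h3 c)
  rw [h3 d, if_pos hcd] at this
  exact hne0 d this

omit [DecidableEq κ] in
lemma planeMatrix_mul_apply {i j : ι} (hij : i ≠ j) (a b c d : ℝ) (V : Matrix ι κ ℝ) (l : ι)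
    (e : κ) : (planeMatrix i j a b c d * V) l e =
      if l = i then a * V i e + b * V j e else if l = j then c * V i e + d * V j e else V l e :=
  planeMatrix_mulVec hij a b c d (fun l => V l e) l

omit [DecidableEq κ] in
/-- A multiple of a basis vector can be rotated to another basis vector of the same sign. -/
lemma exists_rotation_column {σ : ι → ℝ} {V : Matrix ι κ ℝ} {c : κ} {i t : ι} (hit : i ≠ t)
    (h : σ i = σ t) {a : ℝ} (ha : a ^ 2 = 1) (hc : ∀ l, V l c = if l = i then a else 0) :
    ∃ g, InIdComponent σ g ∧ (∀ l, (g * V) l c = if l = t then 1 else 0) ∧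
      ∀ d, V i d = 0 → V t d = 0 → ∀ l, (g * V) l d = V l d := by
  have key (θ : ℝ) (h1 : Real.cos θ = 0) (h2 : Real.sin θ * a = 1) : _ :=
    (⟨_, inIdComponent_rotation hit h θ, fun l => by
      rw [planeMatrix_mul_apply hit, hc i, hc t, hc l, h1]
      split_ifs <;> simp_all, fun d hi ht l => by
      rw [planeMatrix_mul_apply hit, hi, ht]
      split_ifs <;> simp_all⟩ : ∃ g, InIdComponent σ g ∧
        (∀ l, (g * V) l c = if l = t then 1 else 0) ∧
        ∀ d, V i d = 0 → V t d = 0 → ∀ l, (g * V) l d = V l d)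
  -- The sign of `a` decides the direction of the quarter turn.
  rcases sq_eq_sq_iff_eq_or_eq_neg.mp (ha.trans (one_pow 2).symm) with rfl | rfl
  · exact key (Real.pi / 2) (by simp) (by simp)
  · exact key (-(Real.pi / 2)) (by simp) (by simp)

/-- A wrong sign at `π c` is repaired by two quarter turns, to `π e` and back. The position `π e`
has the same weight and is not used by the columns in `s`, which therefore stay fixed. -/
lemma exists_monomial_column_of_spare {σ : ι → ℝ} {J : κ → ℝ} {V : Matrix ι κ ℝ}
    (hσ : ∀ l, σ l = 1 ∨ σ l = -1) (hJ : ∀ c, J c = 1 ∨ J c = -1)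
    (hV : (σ, V) ∈ congrFiber ι (diagonal J)) {π : κ → ι} (hπ : Function.Injective π)
    (hπJ : ∀ c, σ (π c) = J c) {s : Finset κ} (hs : ∀ d ∈ s, ∀ l, V l d = if l = π d then 1 else 0)
    {c e : κ} (hc : c ∉ s) (he : e ∉ s) (hce : c ≠ e) (hJce : J c = J e) :
    ∃ g, InIdComponent σ g ∧ (∀ l, (g * V) l c = if l = π c then 1 else 0) ∧
      ∀ d ∈ s, ∀ l, (g * V) l d = V l d := by
  obtain ⟨g, i, a, hg, h1, h2, h3, h4⟩ := exists_column_monomial hσ hJ hV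
    (fun d hd => ⟨π d, 1, one_ne_zero, hs d hd⟩) hc
  have hgV := mul_mem_congrFiber hg.mem hV
  have ha : a ≠ 0 := by rintro rfl; simp at h3
  have hrow (d) (hd : d ∈ s) : (g * V) i d = 0 :=
    apply_eq_zero_of_column_eq hσ hgV (by rintro rfl; exact hc hd) ha h1
  have hrow' (f) (hf : f ∉ s) (d) (hd : d ∈ s) : (g * V) (π f) d = 0 := by
    rw [h4 d hd, hs d hd, if_neg]
    exact fun h => hf (hπ h ▸ hd)
  by_cases hi : i = π c
  · rcases sq_eq_sq_iff_eq_or_eq_neg.mp (h3.trans (one_pow 2).symm) with rfl | rfl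
    · exact ⟨g, hg, fun l => by rw [h1, hi], h4⟩
    · have hne : i ≠ π e := by rw [hi]; exact fun h => hce (hπ h)
      obtain ⟨p, hp, hp1, hp2⟩ := exists_rotation_column (σ := σ) (V := g * V) hne
        (by rw [h2, hπJ, hJce]) (by norm_num) h1
      have hpV := mul_mem_congrFiber hp.mem hgV
      obtain ⟨q, hq, hq1, hq2⟩ := exists_rotation_column (σ := σ) (V := p * (g * V)) (t := π c)
        (by rw [← hi]; exact hne.symm) (by rw [hπJ, hπJ, hJce]) (by norm_num) hp1
      refine ⟨q * (p * g), hq.mul (hp.mul hg), ?_, fun d hd l => ?_⟩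
      · simpa only [Matrix.mul_assoc] using hq1
      · have e1 (l) := hp2 d (hrow d hd) (hrow' e he d hd) l
        rw [Matrix.mul_assoc, Matrix.mul_assoc, hq2 d, e1, h4 d hd]
        · rw [e1]; exact hrow' e he d hd
        · rw [e1]; exact hrow' c hc d hd
  · obtain ⟨p, hp, hp1, hp2⟩ := exists_rotation_column (σ := σ) (V := g * V) hi
      (by rw [h2, hπJ]) h3 h1
    refine ⟨p * g, hp.mul hg, ?_, fun d hd l => ?_⟩
    · simpa only [Matrix.mul_assoc] using hp1
    · rw [Matrix.mul_assoc, hp2 d (hrow d hd) (hrow' c hc d hd), h4 d hd]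

/-- A square solution of `Vᵀ diag(σ) V = diag(J)` can be moved to a signed monomial matrix with
prescribed positions, with free signs only in one column for each sign of `J`. -/
lemma exists_inIdComponent_mul_eq_monomialMatrix_of_bijective [Fintype κ] {σ : ι → ℝ} {J : κ → ℝ}
    {V : Matrix ι κ ℝ} (hσ : ∀ l, σ l = 1 ∨ σ l = -1) (hJ : ∀ c, J c = 1 ∨ J c = -1)
    (hV : (σ, V) ∈ congrFiber ι (diagonal J)) {π : κ → ι} (hπ : Function.Bijective π)
    (hπJ : ∀ c, σ (π c) = J c) {T : Finset κ} (hT : ∀ c, ∃ t ∈ T, J t = J c)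
    (hTinj : Set.InjOn J T) :
    ∃ g a, InIdComponent σ g ∧ g * V = monomialMatrix π a ∧ (∀ c, a c ^ 2 = 1) ∧
      ∀ c, c ∉ T → a c = 1 := by
  -- Columns outside `T` come first: the member of `T` with the same sign serves as the spare
  -- column.
  have key1 (s : Finset κ) (hsT : Disjoint s T) :
      ∃ g, InIdComponent σ g ∧ ∀ c ∈ s, ∀ l, (g * V) l c = if l = π c then 1 else 0 := by
    induction s using Finset.induction_on with
    | empty => exact ⟨1, .one σ, by simp⟩
    | insert c s hc ih =>
      rw [Finset.disjoint_insert_left] at hsT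
      obtain ⟨g, hg, hs⟩ := ih hsT.2
      obtain ⟨t, ht, htc⟩ := hT c
      obtain ⟨g', hg', h1, h2⟩ := exists_monomial_column_of_spare hσ hJ
        (mul_mem_congrFiber hg.mem hV) hπ.1 hπJ hs hc
        (fun h => Finset.disjoint_left.mp hsT.2 h ht)
        (by rintro rfl; exact hsT.1 ht) htc.symm
      refine ⟨g' * g, hg'.mul hg, fun d hd => ?_⟩
      rw [Matrix.mul_assoc]
      rcases Finset.mem_insert.mp hd with rfl | hd
      · exact h1
      · intro l
        rw [h2 d hd, hs d hd]
  have key2 (u : Finset κ) : ∃ (g : Matrix ι ι ℝ) (a : κ → ℝ), InIdComponent σ g ∧ (∀ c, a c ^ 2 = 1) ∧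
      (∀ c, c ∉ T → a c = 1) ∧
      ∀ c ∈ Tᶜ ∪ u, ∀ l, (g * V) l c = if l = π c then a c else 0 := by
    induction u using Finset.induction_on with
    | empty =>
      obtain ⟨g, hg, h⟩ := key1 Tᶜ disjoint_compl_left
      exact ⟨g, fun _ => 1, hg, by simp, by simp, by simpa using h⟩
    | insert c u hc ih =>
      obtain ⟨g, a, hg, ha, ha', hs⟩ := ih
      have hne0 (c) : a c ≠ 0 := fun h => by simpa [h] using ha c
      by_cases hcT : c ∈ T
      · obtain ⟨g', i, b, hg', h1, h2, h3, h4⟩ := exists_column_monomial hσ hJ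
          (mul_mem_congrFiber hg.mem hV) (fun d hd => ⟨π d, a d, hne0 d, hs d hd⟩)
          (c := c) (by simp [hcT, hc])
        have hgV := mul_mem_congrFiber hg'.mem (mul_mem_congrFiber hg.mem hV)
        have hb : b ≠ 0 := by rintro rfl; simp at h3
        obtain ⟨c', rfl⟩ := hπ.2 i
        have hc's : c' ∉ Tᶜ ∪ u := by
          intro h
          have := apply_eq_zero_of_column_eq hσ hgV (c := c) (d := c')
            (by rintro rfl; simp [hc, hcT] at h) hb h1
          rw [h4 c' h, hs c' h, if_pos rfl] at this
          exact hne0 _ this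
        -- The occupied position belongs to a column of `T` of the same sign; `T` has only one, so
        -- the position is forced and only the sign `b` is free.
        have hcc : c' = c := by
          simp only [Finset.mem_union, Finset.mem_compl, not_or, not_not] at hc's
          exact hTinj hc's.1 hcT (by rw [← h2, hπJ])
        subst hcc
        refine ⟨g' * g, Function.update a c' b, hg'.mul hg, fun d => ?_, fun d hd => ?_, ?_⟩
        · by_cases h : d = c'
          · subst h; simpa using h3
          · simpa [h] using ha d
        · rw [Function.update_of_ne (by rintro rfl; exact hd hcT), ha' d hd]
        · intro d hd l
          rw [Matrix.mul_assoc]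
          by_cases h : d = c'
          · subst h; simpa using h1 l
          · have hd' : d ∈ Tᶜ ∪ u := by
              simp only [Finset.mem_union, Finset.mem_insert] at hd ⊢
              tauto
            rw [Function.update_of_ne h, h4 d hd', hs d hd']
      · refine ⟨g, a, hg, ha, ha', fun d hd => hs d ?_⟩
        simp only [Finset.mem_union, Finset.mem_insert, Finset.mem_compl] at hd ⊢
        rcases hd with hd | rfl | hd <;> tauto
  obtain ⟨g, a, hg, ha, ha', h⟩ := key2 Finset.univ
  exact ⟨g, a, hg, by ext l c; exact h c (by simp) l, ha, ha'⟩

end Monomial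

/-! ### Paths in the fiber that change weights and remove rows -/

section Moves

open Matrix

variable {ι κ μ : Type*} [Fintype ι] [DecidableEq ι] {S : Matrix μ μ ℝ}

lemma joinedIn_of_curve {X : Type*} [TopologicalSpace X] {F : Set X} {f : ℝ → X}
    (hf : Continuous f) (h : ∀ t, f t ∈ F) {x y : X} (h0 : f 0 = x) (h1 : f 1 = y) :
    JoinedIn F x y :=
  JoinedIn.ofLine hf.continuousOn h0 h1 (by rintro _ ⟨t, -, rfl⟩; exact h t)

lemma mem_congrFiber_of_rows_eq {p q : (ι → ℝ) × Matrix ι μ ℝ} (hp : p ∈ congrFiber ι S)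
    (h : ∀ i c d, q.1 i * (q.2 i c * q.2 i d) = p.1 i * (p.2 i c * p.2 i d)) :
    q ∈ congrFiber ι S := by
  rw [mem_congrFiber_iff] at *
  intro c d
  rw [← hp c d]
  exact Finset.sum_congr rfl fun i _ => h i c d

/-- Scaling a row by `exp s` and its weight by `exp (-2 s)` keeps its contribution. A row of weight
zero is first shrunk to zero, after which its weight can move to 1. -/
lemma exists_joinedIn_unit_weights {α : ι → ℝ} {W : Matrix ι μ ℝ}
    (h : (α, W) ∈ congrFiber ι S) :
    ∃ σ W', (∀ l, σ l = 1 ∨ σ l = -1) ∧ JoinedIn (congrFiber ι S) (α, W) (σ, W') := by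
  set lam : ι → ℝ := fun i => Real.log |α i| / 2
  set W' : Matrix ι μ ℝ :=
    Matrix.of fun i c => if α i = 0 then 0 else Real.exp (lam i) * W i c
  have h1 : JoinedIn (congrFiber ι S) (α, W) (fun i => α i * Real.exp (-2 * lam i), W') := by
    refine joinedIn_of_curve (f := fun t => (fun i => α i * Real.exp (-2 * (t * lam i)),
      Matrix.of fun i c => if α i = 0 then (1 - t) * W i c else Real.exp (t * lam i) * W i c)) ?_ ?_ ?_ ?_
    · refine Continuous.prodMk (by fun_prop) (continuous_matrix fun i c => ?_)
      simp only [Matrix.of_apply]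
      split_ifs <;> fun_prop
    · intro t
      refine mem_congrFiber_of_rows_eq h fun i c d => ?_
      by_cases hi : α i = 0
      · simp [hi]
      · have : Real.exp (-2 * (t * lam i)) * (Real.exp (t * lam i) * Real.exp (t * lam i)) = 1 := by
          rw [← Real.exp_add, ← Real.exp_add]
          ring_nf
          exact Real.exp_zero
        simp only [Matrix.of_apply, hi, if_false]
        linear_combination α i * (W i c * W i d) * this
    · ext <;> simp
    · ext <;> simp [W']
  refine ⟨fun i => if α i = 0 then 1 else α i * Real.exp (-2 * lam i), W', fun i => ?_,
    h1.trans ?_⟩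
  · by_cases hi : α i = 0
    · simp [hi]
    · have : Real.exp (-2 * lam i) = |α i|⁻¹ := by
        rw [show -2 * lam i = -Real.log |α i| by simp only [lam]; ring, Real.exp_neg,
          Real.exp_log (abs_pos.mpr hi)]
      simp only [hi, if_false, this]
      rcases lt_or_gt_of_ne hi with h | h
      · rw [abs_of_neg h]; right; field_simp
      · rw [abs_of_pos h]; left; field_simp
  · refine joinedIn_of_curve (f := fun t =>
      (fun i => if α i = 0 then t else α i * Real.exp (-2 * lam i), W')) ?_ ?_ ?_ rfl
    · refine Continuous.prodMk (continuous_pi fun i => ?_) continuous_const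
      split_ifs <;> fun_prop
    · intro t
      refine mem_congrFiber_of_rows_eq h1.target_mem fun i c d => ?_
      by_cases hi : α i = 0 <;> simp [hi, W']
    · ext i
      · by_cases hi : α i = 0 <;> simp [hi]
      · rfl

/-- A row can be moved, with a possible change of sign, to a position of weight zero. -/
lemma joinedIn_transfer_row {α : ι → ℝ} {W : Matrix ι μ ℝ} (h : (α, W) ∈ congrFiber ι S)
    {i j : ι} (hij : i ≠ j) (hi : α i = 0) {b : ℝ} (hb : b ^ 2 = 1) :
    JoinedIn (congrFiber ι S) (α, W) (Function.update (Function.update α i (α j)) j 0,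
      Matrix.updateRow (Matrix.updateRow W i (b • W j)) j 0) := by
  -- Three moves: copy the row to the weightless position, shift the weight across, then erase the
  -- original, now weightless.
  have h1 : JoinedIn (congrFiber ι S) (α, W) (α, Matrix.updateRow W i (b • W j)) := by
    refine joinedIn_of_curve (f := fun t : ℝ =>
      (α, Matrix.updateRow W i ((1 - t) • W i + t • b • W j))) ?_ ?_ ?_ ?_
    · exact Continuous.prodMk continuous_const
        (Continuous.matrix_updateRow i continuous_const (by fun_prop))
    · intro t
      refine mem_congrFiber_of_rows_eq h fun l c d => ?_
      by_cases hl : l = i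
      · subst hl; simp [hi]
      · simp [hl]
    · simp
    · simp
  have h2 : JoinedIn (congrFiber ι S) (α, Matrix.updateRow W i (b • W j))
      (Function.update (Function.update α i (α j)) j 0, Matrix.updateRow W i (b • W j)) := by
    refine joinedIn_of_curve (f := fun t : ℝ =>
      (Function.update (Function.update α i (t * α j)) j ((1 - t) * α j),
        Matrix.updateRow W i (b • W j))) ?_ ?_ ?_ ?_
    · exact Continuous.prodMk ((continuous_const.update i (by fun_prop)).update j (by fun_prop))
        continuous_const
    · intro t
      have := h1.target_mem
      rw [mem_congrFiber_iff] at this ⊢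
      intro c d
      rw [← this c d, ← sub_eq_zero, ← Finset.sum_sub_distrib,
        Finset.sum_eq_add i j hij (fun l _ hl => by simp [hl.1, hl.2]) (by simp) (by simp)]
      simp only [Function.update_self, Function.update_of_ne hij, Matrix.updateRow_self,
        Matrix.updateRow_ne hij.symm, Pi.smul_apply, smul_eq_mul, hi]
      linear_combination (t * α j * W j c * W j d) * hb
    · ext l
      · by_cases hl : l = j
        · subst hl; simp
        · by_cases hl' : l = i
          · subst hl'; simp [hl, hi]
          · simp [hl, hl']
      · rfl
    · simp
  refine (h1.trans h2).trans ?_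
  refine joinedIn_of_curve (f := fun t : ℝ =>
    (Function.update (Function.update α i (α j)) j 0,
      Matrix.updateRow (Matrix.updateRow W i (b • W j)) j ((1 - t) • W j))) ?_ ?_ ?_ ?_
  · exact Continuous.prodMk continuous_const
      (Continuous.matrix_updateRow j continuous_const (by fun_prop))
  · intro t
    refine mem_congrFiber_of_rows_eq h2.target_mem fun l c d => ?_
    by_cases hl : l = j
    · subst hl; simp
    · simp [hl]
  · ext l c
    · rfl
    · by_cases hl : l = j
      · subst hl; simp [hij.symm]
      · simp [hl]
  · simp

/-- A dependence between the nonzero rows allows to move some nonzero row to zero. -/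
lemma exists_joinedIn_fewer_rows {σ : ι → ℝ} (hσ : ∀ l, σ l = 1 ∨ σ l = -1)
    {W : Matrix ι μ ℝ} (hW : (σ, W) ∈ congrFiber ι S) {v : ι → ℝ} (hv : v ≠ 0)
    (hsupp : ∀ l, v l ≠ 0 → W l ≠ 0) (hsum : ∀ c, ∑ l, σ l * (v l * W l c) = 0) :
    ∃ W', JoinedIn (congrFiber ι S) (σ, W) (σ, W') ∧ (∀ l, W' l ≠ 0 → W l ≠ 0) ∧
      ∃ l, W l ≠ 0 ∧ W' l = 0 := by
  obtain ⟨g, hg, hrow, -, hnull⟩ := exists_inIdComponent_pairwise_null hσ v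
  set u := g *ᵥ v with hu
  have hσ0 (l) : σ l ≠ 0 := by rcases hσ l with h | h <;> simp [h]
  have huv (l) (hl : u l ≠ 0) : v l ≠ 0 := fun h => hl (by rw [hu, hrow l h, h])
  have hu0 : ∃ i, u i ≠ 0 := by
    by_contra! h
    have hu0 : u = 0 := funext h
    refine hv (funext fun l => ?_)
    have h1 : (gᵀ * diagonal σ * g) *ᵥ v = 0 := by
      rw [← mulVec_mulVec, ← hu, hu0, mulVec_zero]
    rw [hg.mem] at h1
    have := congrFun h1 l
    rw [mulVec_diagonal] at this
    simpa [hσ0] using this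
  obtain ⟨i, hi⟩ := hu0
  have hsum' (c) : ∑ l, σ l * (u l * (g * W) l c) = 0 := by
    have h1 : u ᵥ* (diagonal σ * (g * W)) = v ᵥ* (diagonal σ * W) := by
      rw [hu, ← vecMul_transpose, vecMul_vecMul]
      congr 1
      rw [← Matrix.mul_assoc, ← Matrix.mul_assoc, hg.mem]
    have h3 := congrFun h1 c
    simp only [vecMul, dotProduct, diagonal_mul] at h3
    rw [← hsum c]
    convert h3 using 2 <;> ring
  -- The rows in the support of `u` contribute nothing to `S`. The support has at most two elements.
  -- If it has one, the dependence makes that row zero; if two, they have opposite weights and the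
  -- dependence makes the rows equal up to sign. Hence these rows can be scaled to zero together.
  have hcancel (c d) : ∑ l, (if u l = 0 then 0 else σ l * ((g * W) l c * (g * W) l d)) = 0 := by
    by_cases h : ∃ j, j ≠ i ∧ u j ≠ 0
    · obtain ⟨j, hji, hj⟩ := h
      have hother (l) (hli : l ≠ i) (hlj : l ≠ j) : u l = 0 := by
        by_contra h
        have h1 := hnull l i hli h hi
        have h2 := hnull l j hlj h hj
        have h3 := hnull j i hji hj hi
        have h4 : σ i * u i ^ 2 = 0 := by linarith
        simp_all
      have h3 := hnull j i hji hj hi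
      rw [Finset.sum_eq_add i j hji.symm (fun l _ hl => by rw [if_pos (hother l hl.1 hl.2)])
        (by simp) (by simp), if_neg hi, if_neg hj]
      have e (c) : σ i * (u i * (g * W) i c) + σ j * (u j * (g * W) j c) = 0 := by
        rw [← hsum' c, Finset.sum_eq_add i j hji.symm
          (fun l _ hl => by rw [hother l hl.1 hl.2]; ring) (by simp) (by simp)]
      have hsq : σ i ^ 2 = 1 ∧ σ j ^ 2 = 1 :=
        ⟨by rcases hσ i with h | h <;> simp [h], by rcases hσ j with h | h <;> simp [h]⟩
      have hu2 : u i ^ 2 * (σ i * ((g * W) i c * (g * W) i d) +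
          σ j * ((g * W) j c * (g * W) j d)) = 0 := by
        have e1 : σ i * u i * (g * W) i c = -(σ j * u j * (g * W) j c) := by linarith [e c]
        have e2 : σ i * u i * (g * W) i d = -(σ j * u j * (g * W) j d) := by linarith [e d]
        have e3 : u i ^ 2 * ((g * W) i c * (g * W) i d) =
            u j ^ 2 * ((g * W) j c * (g * W) j d) := by
          have := congrArg₂ (· * ·) e1 e2
          linear_combination this - (u i ^ 2 * ((g * W) i c * (g * W) i d)) * hsq.1 +
            (u j ^ 2 * ((g * W) j c * (g * W) j d)) * hsq.2
        linear_combination σ i * e3 + ((g * W) j c * (g * W) j d) * (σ i * σ j * h3 -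
          σ i * u j ^ 2 * hsq.2 - σ j * u i ^ 2 * hsq.1)
      simpa [hi] using hu2
    · push Not at h
      rw [Finset.sum_eq_single i (fun l _ hl => by rw [if_pos (h l hl)]) (by simp), if_neg hi]
      have := hsum' c
      rw [Finset.sum_eq_single i (fun l _ hl => by rw [h l hl]; ring) (by simp)] at this
      have : (g * W) i c = 0 := by simpa [hσ0, hi] using this
      simp [this]
  refine ⟨Matrix.of fun l c => if u l = 0 then (g * W) l c else 0, (hg.joinedIn hW).trans ?_, ?_, ?_⟩
  · refine joinedIn_of_curve (f := fun t : ℝ =>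
      (σ, Matrix.of fun l c => if u l = 0 then (g * W) l c else (1 - t) * (g * W) l c)) ?_ ?_ ?_ ?_
    · refine Continuous.prodMk continuous_const (continuous_matrix fun l c => ?_)
      simp only [Matrix.of_apply]
      split_ifs <;> fun_prop
    · intro t
      have := mul_mem_congrFiber hg.mem hW
      rw [mem_congrFiber_iff] at this ⊢
      intro c d
      have h0 := congrArg (((1 - t) ^ 2 - 1) * ·) (hcancel c d)
      simp only [mul_zero] at h0
      rw [← this c d, ← sub_eq_zero, ← Finset.sum_sub_distrib]
      refine Eq.trans ?_ h0
      rw [Finset.mul_sum]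
      refine Finset.sum_congr rfl fun l _ => ?_
      by_cases hl : u l = 0
      · simp [hl]
      · simp only [Matrix.of_apply, hl, if_false]; ring
    · ext <;> simp
    · ext l c
      · rfl
      · by_cases hl : u l = 0 <;> simp [hl]
  · intro l hl
    by_cases hul : u l = 0
    · by_cases hvl : v l = 0
      · intro h
        refine hl (funext fun c => ?_)
        have : (g * W) l c = W l c := hrow l hvl fun m => W m c
        rw [Matrix.of_apply, if_pos hul, this, h]
      · exact hsupp l hvl
    · exact absurd (funext fun c => by simp [hul]) hl
  · exact ⟨i, hsupp i (huv i hi), funext fun c => by simp [hi]⟩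

/-- Every point of the fiber is joined to one with unit weights whose rows vanish on the kernel
of `S`. -/
lemma exists_joinedIn_ker_le [Fintype μ] {α : ι → ℝ} {W : Matrix ι μ ℝ}
    (h : (α, W) ∈ congrFiber ι S) :
    ∃ σ W', (∀ l, σ l = 1 ∨ σ l = -1) ∧ JoinedIn (congrFiber ι S) (α, W) (σ, W') ∧
      ∀ x, S *ᵥ x = 0 → W' *ᵥ x = 0 := by
  classical
  obtain ⟨σ, W₁, hσ, h₁⟩ := exists_joinedIn_unit_weights h
  have key (W : Matrix ι μ ℝ) (hW : (σ, W) ∈ congrFiber ι S) :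
      ∃ W', JoinedIn (congrFiber ι S) (σ, W) (σ, W') ∧ ∀ x, S *ᵥ x = 0 → W' *ᵥ x = 0 := by
    induction hn : (Finset.univ.filter fun l => W l ≠ 0).card using Nat.strong_induction_on
      generalizing W with
    | _ n ih =>
      by_cases hx : ∀ x, S *ᵥ x = 0 → W *ᵥ x = 0
      · exact ⟨W, .refl hW, hx⟩
      push Not at hx
      obtain ⟨x, hSx, hWx⟩ := hx
      -- The dependence has coefficients `W x`, since `Wᵀ diag(σ) (W x) = S x = 0`.
      obtain ⟨W', hj, hsub, l, hl, hl'⟩ := exists_joinedIn_fewer_rows hσ hW hWx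
        (fun l hl h0 => hl (by simp [mulVec, h0])) (fun c => by
          have := congrFun hSx c
          rw [← show Wᵀ * diagonal σ * W = S from hW, ← mulVec_mulVec, ← mulVec_mulVec] at this
          simp only [mulVec_transpose, vecMul, dotProduct, mulVec_diagonal, Pi.zero_apply] at this
          rw [← this]
          refine Finset.sum_congr rfl fun l _ => ?_
          simp only [mulVec, dotProduct]
          ring)
      obtain ⟨W'', hj', hx⟩ := ih _ (by
        rw [← hn]
        refine Finset.card_lt_card (Finset.ssubset_iff_of_subset ?_ |>.mpr ⟨l, ?_, ?_⟩)
        · intro l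
          simpa using hsub l
        · simpa using hl
        · simpa using hl') W' hj.target_mem rfl
      exact ⟨W'', hj.trans hj', hx⟩
  obtain ⟨W', hj, hx⟩ := key W₁ h₁.target_mem
  exact ⟨σ, W', hσ, h₁.trans hj, hx⟩

end Moves

/-! ### Reduction to the diagonal form, and connectedness when there is a spare row -/

section Connected

open Matrix

variable {ι κ μ : Type*} [Fintype ι] [DecidableEq ι] [Fintype κ] [DecidableEq κ]

omit [DecidableEq κ] in
lemma mul_right_mem_congrFiber {M : Matrix κ κ ℝ} {α : ι → ℝ} {V : Matrix ι κ ℝ}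
    (h : (α, V) ∈ congrFiber ι M) (B : Matrix κ μ ℝ) :
    (α, V * B) ∈ congrFiber ι (Bᵀ * M * B) := by
  rw [congrFiber, Set.mem_ofPred_eq] at *
  rw [← h, transpose_mul]
  simp only [Matrix.mul_assoc]

omit [DecidableEq κ] in
lemma JoinedIn.mul_right_congrFiber {M : Matrix κ κ ℝ} {α β : ι → ℝ} {V W : Matrix ι κ ℝ}
    (h : JoinedIn (congrFiber ι M) (α, V) (β, W)) (B : Matrix κ μ ℝ) :
    JoinedIn (congrFiber ι (Bᵀ * M * B)) (α, V * B) (β, W * B) := by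
  refine (JoinedIn.map h (f := fun p => (p.1, p.2 * B)) (by fun_prop)).mono ?_
  rintro _ ⟨p, hp, rfl⟩
  exact mul_right_mem_congrFiber hp B

omit [Fintype ι] [DecidableEq ι] in
-- The vector `x - R W₀ x` is killed by `W₀`, hence by `W₀ᵀ M W₀`, hence by `W`.
lemma eq_mul_mul_of_ker_le [Fintype μ] {M : Matrix κ κ ℝ} {W₀ : Matrix κ μ ℝ} {R : Matrix μ κ ℝ}
    (hR : W₀ * R = 1) {W : Matrix ι μ ℝ} (h : ∀ x, (W₀ᵀ * M * W₀) *ᵥ x = 0 → W *ᵥ x = 0) :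
    W = W * R * W₀ := by
  classical
  refine Matrix.mulVec_injective (funext fun x => ?_)
  have h0 := h (x - (R * W₀) *ᵥ x) (by
    rw [mulVec_sub, mulVec_mulVec, Matrix.mul_assoc, Matrix.mul_assoc, Matrix.mul_assoc,
      ← Matrix.mul_assoc W₀ R W₀, hR, Matrix.one_mul, sub_self])
  rw [mulVec_sub, sub_eq_zero, mulVec_mulVec, ← Matrix.mul_assoc] at h0
  exact h0

lemma mul_rightInverse_mem_congrFiber [Fintype μ] {M : Matrix κ κ ℝ} {W₀ : Matrix κ μ ℝ}
    {R : Matrix μ κ ℝ} (hR : W₀ * R = 1) {α : ι → ℝ} {W : Matrix ι μ ℝ}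
    (h : (α, W) ∈ congrFiber ι (W₀ᵀ * M * W₀)) : (α, W * R) ∈ congrFiber ι M := by
  classical
  have := mul_right_mem_congrFiber h R
  rwa [show Rᵀ * (W₀ᵀ * M * W₀) * R = (W₀ * R)ᵀ * M * (W₀ * R) by
    simp only [transpose_mul, Matrix.mul_assoc], hR, transpose_one, Matrix.one_mul,
    Matrix.mul_one] at this

/-- The weights equal to `J c` at position `π c` and zero elsewhere. -/
def weightsAt (π : κ → ι) (J : κ → ℝ) : ι → ℝ := fun i => ∑ c, if i = π c then J c else 0

omit [Fintype ι] in
lemma weightsAt_apply {π : κ → ι} (hπ : Function.Injective π) (J : κ → ℝ) (c : κ) :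
    weightsAt π J (π c) = J c := by
  simp [weightsAt, hπ.eq_iff]

omit [Fintype ι] [DecidableEq κ] in
lemma weightsAt_of_notMem {π : κ → ι} (J : κ → ℝ) {i : ι} (hi : ∀ c, i ≠ π c) :
    weightsAt π J i = 0 := by
  simp [weightsAt, hi]

lemma mem_congrFiber_weightsAt {π : κ → ι} (hπ : Function.Injective π) (J : κ → ℝ)
    {a : κ → ℝ} (ha : ∀ c, a c ^ 2 = 1) :
    (weightsAt π J, monomialMatrix π a) ∈ congrFiber ι (diagonal J) := by
  rw [mem_congrFiber_iff]
  intro c d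
  simp only [monomialMatrix, ite_mul, zero_mul, mul_ite, mul_zero, Finset.sum_ite_eq',
    Finset.mem_univ, if_true, weightsAt_apply hπ]
  by_cases hcd : c = d
  · subst hcd
    simp only [if_true, diagonal_apply_eq]
    linear_combination J c * ha c
  · simp [hπ.eq_iff, hcd, Ne.symm hcd]

lemma joinedIn_weightsAt {σ : ι → ℝ} {π : κ → ι} (hπ : Function.Injective π) {J a : κ → ℝ}
    (hσ : ∀ c, σ (π c) = J c) (h : (σ, monomialMatrix π a) ∈ congrFiber ι (diagonal J)) :
    JoinedIn (congrFiber ι (diagonal J)) (σ, monomialMatrix π a)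
      (weightsAt π J, monomialMatrix π a) := by
  refine joinedIn_of_curve (f := fun t : ℝ =>
    (σ + t • (weightsAt π J - σ), monomialMatrix π a)) (by fun_prop) ?_ (by simp) (by simp)
  intro t
  refine mem_congrFiber_of_rows_eq h fun i c d => ?_
  by_cases hi : ∃ c, i = π c
  · obtain ⟨e, rfl⟩ := hi
    simp [weightsAt_apply hπ, hσ]
  · push Not at hi
    simp [monomialMatrix, hi]

lemma joinedIn_update_position {π : κ → ι} (hπ : Function.Injective π) {J a : κ → ℝ}
    (ha : ∀ c, a c ^ 2 = 1) {i : ι} (hi : ∀ c, i ≠ π c) (c : κ) {b : ℝ} (hb : b ^ 2 = 1) :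
    JoinedIn (congrFiber ι (diagonal J)) (weightsAt π J, monomialMatrix π a)
      (weightsAt (Function.update π c i) J,
        monomialMatrix (Function.update π c i) (Function.update a c b)) := by
  -- The moved row has entry `a c`; the factor `b * a c` turns it into `b`, as `a c ^ 2 = 1`.
  have h := joinedIn_transfer_row (mem_congrFiber_weightsAt hπ J ha) (hi c)
    (weightsAt_of_notMem J hi) (b := b * a c) (by rw [mul_pow, hb, ha, one_mul])
  convert h using 2
  · ext l
    by_cases hl : l = π c
    · subst hl
      rw [Function.update_self, weightsAt_of_notMem]
      intro d
      by_cases hd : d = c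
      · subst hd; simpa using (hi d).symm
      · rw [Function.update_of_ne hd]
        exact fun h => hd (hπ h).symm
    · rw [Function.update_of_ne hl]
      by_cases hl' : l = i
      · subst hl'
        rw [Function.update_self, weightsAt_apply hπ, weightsAt,
          Finset.sum_eq_single c (fun d _ hd => by simp [hd, hi d]) (by simp)]
        simp
      · rw [Function.update_of_ne hl']
        refine Finset.sum_congr rfl fun d _ => ?_
        by_cases hd : d = c
        · subst hd; simp [hl, hl']
        · simp [hd]
  · ext l d
    by_cases hl : l = π c
    · subst hl
      rw [Matrix.updateRow_self, monomialMatrix, if_neg]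
      · rfl
      · by_cases hd : d = c
        · subst hd; simpa using (hi d).symm
        · rw [Function.update_of_ne hd]
          exact fun h => hd (hπ h).symm
    · rw [Matrix.updateRow_ne hl]
      by_cases hl' : l = i
      · subst hl'
        rw [Matrix.updateRow_self]
        by_cases hd : d = c
        · subst hd
          simp only [monomialMatrix, Function.update_self, if_true, Pi.smul_apply, smul_eq_mul]
          linear_combination (-b) * ha d
        · simp [monomialMatrix, hd, hi d, hπ.eq_iff, Ne.symm hd]
      · rw [Matrix.updateRow_ne hl']
        by_cases hd : d = c
        · subst hd; simp [monomialMatrix, hl, hl']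
        · simp [monomialMatrix, hd]

omit [Fintype ι] [DecidableEq ι] [Fintype κ] in
lemma Function.Injective.update_of_notMem {π : κ → ι} (hπ : Function.Injective π) {i : ι}
    (hi : ∀ c, i ≠ π c) (c : κ) : Function.Injective (Function.update π c i) := by
  intro d e hde
  by_cases hd : d = c <;> by_cases he : e = c
  · rw [hd, he]
  · subst hd; simp [he, hi e] at hde
  · subst he; simp [hd, (hi d).symm] at hde
  · simpa [hd, he, hπ.eq_iff] using hde

/-- With a spare position all monomial normal forms are joined to each other. -/
lemma joinedIn_of_card_lt (hcard : Fintype.card κ < Fintype.card ι) {π π₀ : κ → ι}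
    (hπ : Function.Injective π) (hπ₀ : Function.Injective π₀) {J a : κ → ℝ}
    (ha : ∀ c, a c ^ 2 = 1) :
    JoinedIn (congrFiber ι (diagonal J)) (weightsAt π J, monomialMatrix π a)
      (weightsAt π₀ J, monomialMatrix π₀ fun _ => 1) := by
  have free {π : κ → ι} : ∃ i, ∀ c, i ≠ π c := by
    by_contra! h
    exact hcard.not_ge (Fintype.card_le_of_surjective π fun i => (h i).imp fun _ h => h.symm)
  have key (s : Finset κ) : ∃ (π' : κ → ι) (a' : κ → ℝ), Function.Injective π' ∧
      (∀ c, a' c ^ 2 = 1) ∧ (∀ c ∈ s, π' c = π₀ c ∧ a' c = 1) ∧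
      JoinedIn (congrFiber ι (diagonal J)) (weightsAt π J, monomialMatrix π a)
        (weightsAt π' J, monomialMatrix π' a') := by
    induction s using Finset.induction_on with
    | empty => exact ⟨π, a, hπ, ha, by simp, .refl (mem_congrFiber_weightsAt hπ J ha)⟩
    | insert c s hc ih =>
      obtain ⟨π', a', hπ', ha', hs, hj⟩ := ih
      have fin (π' : κ → ι) (hπ' : Function.Injective π') (hs : ∀ c ∈ s, π' c = π₀ c ∧ a' c = 1)
          (hj : JoinedIn (congrFiber ι (diagonal J)) (weightsAt π J, monomialMatrix π a)
            (weightsAt π' J, monomialMatrix π' a')) (hfree : ∀ d, π₀ c ≠ π' d) := by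
        refine (⟨Function.update π' c (π₀ c), Function.update a' c 1,
          hπ'.update_of_notMem hfree c, fun d => ?_, fun d hd => ?_,
          hj.trans (joinedIn_update_position hπ' ha' hfree c (one_pow 2))⟩ :
          ∃ (π' : κ → ι) (a' : κ → ℝ), Function.Injective π' ∧
          (∀ c, a' c ^ 2 = 1) ∧ (∀ d ∈ insert c s, π' d = π₀ d ∧ a' d = 1) ∧
          JoinedIn (congrFiber ι (diagonal J)) (weightsAt π J, monomialMatrix π a)
            (weightsAt π' J, monomialMatrix π' a'))
        · by_cases h : d = c
          · subst h; simp
          · simpa [h] using ha' d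
        · by_cases h : d = c
          · subst h; simp
          · simpa [h] using hs d ((Finset.mem_insert.mp hd).resolve_left h)
      by_cases hfree : ∀ d, π₀ c ≠ π' d
      · exact fin π' hπ' hs hj hfree
      · push Not at hfree
        obtain ⟨d, hd⟩ := hfree
        -- The target of `c` is occupied by column `d`, which first gives way to a free position. As
        -- `π₀` is injective, `d` is not yet settled, unless it is `c` itself, which is harmless.
        obtain ⟨i, hi⟩ := free (π := π')
        have hds : d ∉ s := fun h => hc (by rw [hπ₀ (hd.trans (hs d h).1)]; exact h)
        refine fin (Function.update π' d i) (hπ'.update_of_notMem hi d) (fun e he => ?_) ?_ ?_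
        · rw [Function.update_of_ne (by rintro rfl; exact hds he)]
          exact hs e he
        · have := joinedIn_update_position (J := J) hπ' ha' hi d (ha' d)
          rw [Function.update_eq_self] at this
          exact hj.trans this
        · intro e
          by_cases he : e = d
          · subst he; rw [Function.update_self, hd]; exact (hi e).symm
          · rw [Function.update_of_ne he, hd]
            exact fun h => he (hπ' h).symm
  obtain ⟨π', a', -, -, h, hj⟩ := key Finset.univ
  obtain rfl : π' = π₀ := funext fun c => (h c (Finset.mem_univ c)).1
  obtain rfl : a' = fun _ => 1 := funext fun c => (h c (Finset.mem_univ c)).2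
  exact hj

theorem isConnected_congrFiber_of_card_lt [Fintype μ] (hcard : Fintype.card κ < Fintype.card ι)
    {J : κ → ℝ} (hJ : ∀ c, J c = 1 ∨ J c = -1) {W₀ : Matrix κ μ ℝ} {R : Matrix μ κ ℝ}
    (hR : W₀ * R = 1) : IsConnected (congrFiber ι (W₀ᵀ * diagonal J * W₀)) := by
  obtain ⟨π₀⟩ := Function.Embedding.nonempty_of_card_le hcard.le
  refine IsPathConnected.isConnected ⟨_, mul_right_mem_congrFiber
    (mem_congrFiber_weightsAt π₀.injective J (a := fun _ => 1) (by simp)) W₀, ?_⟩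
  rintro ⟨α, W⟩ hW
  obtain ⟨σ, W', hσ, hj, hker⟩ := exists_joinedIn_ker_le hW
  obtain ⟨g, π, a, hg, hmon, hπJ, ha, hπ⟩ := exists_inIdComponent_mul_eq_monomialMatrix hσ hJ
    (mul_rightInverse_mem_congrFiber hR hj.target_mem)
  have h1 := hg.joinedIn (mul_rightInverse_mem_congrFiber hR hj.target_mem)
  rw [hmon] at h1
  have h2 := ((h1.trans (joinedIn_weightsAt hπ hπJ h1.target_mem)).trans
    (joinedIn_of_card_lt hcard hπ π₀.injective ha)).mul_right_congrFiber W₀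
  rw [← eq_mul_mul_of_ker_le hR hker] at h2
  exact (hj.trans h2).symm

end Connected

/-! ### Sylvester's law of inertia -/

section Diagonalization

open Matrix

lemma toQuadraticForm'_apply {n : ℕ} (S : Matrix (Fin n) (Fin n) ℝ) (x : Fin n → ℝ) :
    S.toQuadraticForm' x = x ⬝ᵥ S *ᵥ x := by
  simp [Matrix.toQuadraticForm', Matrix.toLinearMap₂'_apply']

/-- Polarization on basis vectors. -/
lemma Matrix.IsSymm.eq_zero_of_dotProduct_mulVec_self {n : Type*} [Fintype n]
    {M : Matrix n n ℝ} (hM : M.IsSymm) (h : ∀ x, x ⬝ᵥ M *ᵥ x = 0) : M = 0 := by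
  classical
  ext i j
  have h1 := h (Pi.single i 1 + Pi.single j 1)
  have h2 := h (Pi.single i 1)
  have h3 := h (Pi.single j 1)
  simp only [mulVec_add, add_dotProduct, dotProduct_add, mulVec_single_one, single_one_dotProduct,
    Matrix.col_apply] at h1 h2 h3
  have h4 := hM.apply i j
  rw [Matrix.zero_apply]
  linarith

/-- Sylvester's law of inertia in matrix form, without the zero weights. -/
lemma exists_signed_diagonalization {n : ℕ} (S : Matrix (Fin n) (Fin n) ℝ) (hS : S.IsSymm) :
    ∃ (J : Fin S.rank → ℝ) (W₀ : Matrix (Fin S.rank) (Fin n) ℝ)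
      (R : Matrix (Fin n) (Fin S.rank) ℝ), (∀ c, J c = 1 ∨ J c = -1) ∧
      W₀ᵀ * diagonal J * W₀ = S ∧ W₀ * R = 1 ∧
      {c | 0 < J c}.ncard = sigPos S.toQuadraticForm' ∧
      {c | J c < 0}.ncard = sigNeg S.toQuadraticForm' := by
  obtain ⟨w, hw, hQ⟩ := QuadraticForm.equivalent_one_zero_neg_one_weighted_sum_squared
    S.toQuadraticForm'
  rw [QuadraticForm.sigPos_of_equiv_weightedSumSquares hQ,
    QuadraticForm.sigNeg_of_equiv_weightedSumSquares hQ]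
  obtain ⟨e⟩ := hQ
  set E := LinearMap.toMatrix' (e.toLinearEquiv : (Fin n → ℝ) →ₗ[ℝ]
    (Fin (Module.finrank ℝ (Fin n → ℝ)) → ℝ)) with hE
  set E' := LinearMap.toMatrix' (e.toLinearEquiv.symm :
    (Fin (Module.finrank ℝ (Fin n → ℝ)) → ℝ) →ₗ[ℝ] (Fin n → ℝ)) with hE'
  have hEE' : E * E' = 1 := by
    rw [hE, hE', ← LinearMap.toMatrix'_comp, LinearEquiv.comp_symm, LinearMap.toMatrix'_id]
  have hdiag : S = Eᵀ * diagonal w * E := by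
    rw [← sub_eq_zero]
    refine Matrix.IsSymm.eq_zero_of_dotProduct_mulVec_self ?_ fun x => ?_
    · refine hS.sub ?_
      simp [Matrix.IsSymm, transpose_mul, Matrix.mul_assoc]
    · have h1 : ∑ i, w i * ((E *ᵥ x) i * (E *ᵥ x) i) = x ⬝ᵥ S *ᵥ x := by
        rw [← toQuadraticForm'_apply, ← e.map_app x, QuadraticMap.weightedSumSquares_apply]
        simp [hE, LinearMap.toMatrix'_mulVec]
      rw [sub_mulVec, dotProduct_sub, ← h1, sub_eq_zero, ← mulVec_mulVec, ← mulVec_mulVec,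
        dotProduct_mulVec, vecMul_transpose]
      simp only [dotProduct, mulVec_diagonal]
      exact Finset.sum_congr rfl fun i _ => by ring
  have hrank : Fintype.card {i // w i ≠ 0} = S.rank := by
    rw [← rank_diagonal]
    apply le_antisymm
    · have : diagonal w = E'ᵀ * S * E' := by
        rw [hdiag, show E'ᵀ * (Eᵀ * diagonal w * E) * E' = (E * E')ᵀ * diagonal w * (E * E') by
          simp only [transpose_mul, Matrix.mul_assoc], hEE']
        simp
      rw [this]
      exact (rank_mul_le_left _ _).trans (rank_mul_le_right _ _)
    · conv_lhs => rw [hdiag]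
      exact (rank_mul_le_left _ _).trans (rank_mul_le_right _ _)
  -- `f` enumerates the nonzero weights; restricting to them keeps the product and the right
  -- inverse.
  set f : Fin S.rank → Fin (Module.finrank ℝ (Fin n → ℝ)) :=
    fun k => ((Fintype.equivFinOfCardEq hrank).symm k : _) with hf
  have hfi : Function.Injective f :=
    Subtype.val_injective.comp (Fintype.equivFinOfCardEq hrank).symm.injective
  have hf0 (k) : w (f k) ≠ 0 := ((Fintype.equivFinOfCardEq hrank).symm k).2
  have hfs (i) (hi : w i ≠ 0) : ∃ k, f k = i :=
    ⟨Fintype.equivFinOfCardEq hrank ⟨i, hi⟩, by simp [hf]⟩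
  refine ⟨w ∘ f, E.submatrix f id, E'.submatrix id f, fun c => ?_, ?_, ?_, ?_, ?_⟩
  · have := hf0 c
    rcases hw (f c) with h | h | h <;> simp_all
  · conv_rhs => rw [hdiag]
    ext c d
    rw [transpose_mul_diagonal_mul_apply, transpose_mul_diagonal_mul_apply]
    refine Finset.sum_of_injOn f hfi.injOn (by simp) (fun i _ hi => ?_) (by simp)
    have : w i = 0 := by
      by_contra h
      obtain ⟨k, rfl⟩ := hfs i h
      exact hi (by simp)
    simp [this]
  · rw [← submatrix_mul _ _ _ _ _ Function.bijective_id, hEE', submatrix_one f hfi]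
  · rw [← Set.ncard_image_of_injective _ hfi]
    congr 1
    ext i
    refine ⟨by rintro ⟨k, hk, rfl⟩; exact hk, fun hi => ?_⟩
    obtain ⟨k, rfl⟩ := hfs i (ne_of_gt hi)
    exact ⟨k, hi, rfl⟩
  · rw [← Set.ncard_image_of_injective _ hfi]
    congr 1
    ext i
    refine ⟨by rintro ⟨k, hk, rfl⟩; exact hk, fun hi => ?_⟩
    obtain ⟨k, rfl⟩ := hfs i (ne_of_lt hi)
    exact ⟨k, hi, rfl⟩

end Diagonalization

/-! ### Counting components at full rank -/

section Counting

open Matrix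

lemma card_connectedComponents_eq {X I : Type*} [TopologicalSpace X] {F : Set X} {f : I → X}
    (hf : ∀ i, f i ∈ F) (hsurj : ∀ x ∈ F, ∃ i, JoinedIn F x (f i))
    (hinj : ∀ C ⊆ F, IsPreconnected C → ∀ i j, f i ∈ C → f j ∈ C → i = j) :
    Nat.card (ConnectedComponents F) = Nat.card I := by
  refine (Nat.card_eq_of_bijective (fun i => ConnectedComponents.mk (⟨f i, hf i⟩ : F))
    ⟨fun i j hij => ?_, fun x => ?_⟩).symm
  · simp only [ConnectedComponents.coe_eq_coe] at hij
    refine hinj (Subtype.val '' connectedComponent (⟨f i, hf i⟩ : F)) (by simp)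
      (isPreconnected_connectedComponent.image _ continuous_subtype_val.continuousOn) i j
      ⟨_, mem_connectedComponent, rfl⟩ ⟨⟨f j, hf j⟩, ?_, rfl⟩
    rw [hij]; exact mem_connectedComponent
  · obtain ⟨⟨x, hx⟩, rfl⟩ := ConnectedComponents.surjective_coe x
    obtain ⟨i, hi⟩ := hsurj x hx
    refine ⟨i, ?_⟩
    simp only [ConnectedComponents.coe_eq_coe]
    exact (connectedComponent_eq (pathComponent_subset_component _ hi.joined_subtype)).symm

lemma IsPreconnected.pos_of_pos {X : Type*} [TopologicalSpace X] {C : Set X}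
    (hC : IsPreconnected C) {f : X → ℝ} (hf : ContinuousOn f C) (h0 : ∀ x ∈ C, f x ≠ 0) {x y : X}
    (hx : x ∈ C) (hy : y ∈ C) (h : 0 < f x) : 0 < f y := by
  by_contra! h'
  obtain ⟨z, hz, hz'⟩ := hC.intermediate_value hy hx hf ⟨h', h.le⟩
  exact h0 z hz hz'

variable {κ μ : Type*} [Fintype κ] [DecidableEq κ]

/-- The weights `1` on `A` and `-1` off `A`. -/
def signWeights (A : Finset κ) : κ → ℝ := fun i => if i ∈ A then 1 else -1

omit [Fintype κ] in
lemma signWeights_pos_iff {A : Finset κ} {i : κ} : 0 < signWeights A i ↔ i ∈ A := by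
  unfold signWeights; split_ifs with h <;> simp [h]

lemma weights_ne_zero_of_mem {J : κ → ℝ} (hJ : ∀ c, J c = 1 ∨ J c = -1) {α : κ → ℝ}
    {V : Matrix κ κ ℝ} (h : (α, V) ∈ congrFiber κ (diagonal J)) (i : κ) : α i ≠ 0 := by
  have hdet : (Vᵀ * diagonal α * V).det ≠ 0 := by
    rw [show Vᵀ * diagonal α * V = diagonal J from h, det_diagonal]
    exact Finset.prod_ne_zero_iff.mpr fun c _ => by rcases hJ c with h | h <;> simp [h]
  rw [det_mul, det_mul, det_diagonal] at hdet
  exact Finset.prod_ne_zero_iff.mp (right_ne_zero_of_mul (left_ne_zero_of_mul hdet)) i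
    (Finset.mem_univ i)

lemma exists_perm_signWeights {J : κ → ℝ} (hJ : ∀ c, J c = 1 ∨ J c = -1) {A : Finset κ}
    (hA : A.card = {c | 0 < J c}.ncard) : ∃ π : Equiv.Perm κ, ∀ c, signWeights A (π c) = J c := by
  classical
  have h1 : Fintype.card {c // 0 < J c} = Fintype.card {i // i ∈ A} := by
    rw [Fintype.card_coe, hA, ← Nat.card_coe_set_eq, Nat.card_eq_fintype_card]
    exact Fintype.card_congr (Equiv.refl _)
  have h2 : Fintype.card {c // ¬ 0 < J c} = Fintype.card {i // ¬ i ∈ A} := by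
    rw [Fintype.card_subtype_compl, Fintype.card_subtype_compl, h1]
  refine ⟨Equiv.subtypeCongr (Fintype.equivOfCardEq h1) (Fintype.equivOfCardEq h2), fun c => ?_⟩
  by_cases hc : 0 < J c
  · have := ((Fintype.equivOfCardEq h1) ⟨c, hc⟩).2
    rw [show Equiv.subtypeCongr _ _ c = ((Fintype.equivOfCardEq h1) ⟨c, hc⟩ : κ) by
      simp [Equiv.subtypeCongr, hc], signWeights, if_pos this]
    rcases hJ c with h | h
    · rw [h]
    · rw [h] at hc; norm_num at hc
  · have := ((Fintype.equivOfCardEq h2) ⟨c, hc⟩).2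
    rw [show Equiv.subtypeCongr _ _ c = ((Fintype.equivOfCardEq h2) ⟨c, hc⟩ : κ) by
      simp [Equiv.subtypeCongr, hc], signWeights, if_neg this]
    rcases hJ c with h | h
    · rw [h] at hc; norm_num at hc
    · rw [h]

/-- Combines the columns of `V` with sign `ε` with the columns of a reference matrix `P` with the
opposite sign; its determinant tells apart the two classes of frames of the `ε`-part. -/
noncomputable def mixedBlock (J : κ → ℝ) (P : Matrix κ κ ℝ) (ε : ℝ) (α : κ → ℝ) (V : Matrix κ κ ℝ) :
    Matrix κ κ ℝ :=
  Matrix.of fun i c =>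
    if J c = ε then max 0 (ε * α i) * V i c else max 0 (-(ε * α i)) * P i c

/-- A kernel vector `x` vanishes where `J ≠ ε`, by the rows of weight sign `-ε`. The other rows make
`V x` vanish wherever `α` has sign `ε`. Thus `ε` times the form is at most 0 at `V x`, but it equals
`∑ x c ^ 2`, so `x = 0`. -/
lemma mixedBlock_det_ne_zero {J : κ → ℝ} (hJ : ∀ c, J c = 1 ∨ J c = -1) {ε : ℝ}
    (hε : ε = 1 ∨ ε = -1) {α : κ → ℝ} {V : Matrix κ κ ℝ}
    (h : (α, V) ∈ congrFiber κ (diagonal J)) {π : Equiv.Perm κ}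
    (hπ : ∀ c, 0 < α (π c) * J c) :
    (mixedBlock J (monomialMatrix π fun _ => 1) ε α V).det ≠ 0 := by
  intro hdet
  obtain ⟨x, hx, hNx⟩ := exists_mulVec_eq_zero_iff.mpr hdet
  have hεε : ε * ε = 1 := by rcases hε with h | h <;> simp [h]
  have hopp (c) (hc : J c ≠ ε) : J c = -ε := by
    rcases hJ c with h1 | h1 <;> rcases hε with h2 | h2 <;> simp_all
  have hx0 (c) (hc : J c ≠ ε) : x c = 0 := by
    have h1 := congrFun hNx (π c)
    have hneg : ε * α (π c) < 0 := by
      have := hπ c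
      rw [hopp c hc] at this
      linarith
    have h2 : max 0 (ε * α (π c)) = 0 := max_eq_left hneg.le
    simp only [mulVec, dotProduct, mixedBlock, Matrix.of_apply, monomialMatrix, h2, zero_mul,
      Pi.zero_apply] at h1
    rw [Finset.sum_eq_single c (fun d _ hd => by simp [hd.symm]) (by simp)] at h1
    simp only [hc, if_false, if_true, mul_one, mul_eq_zero] at h1
    refine h1.resolve_left (ne_of_gt ?_)
    rw [lt_max_iff]
    right; linarith
  have hVx (i) (hi : 0 < ε * α i) : (V *ᵥ x) i = 0 := by
    have h1 := congrFun hNx i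
    have h2 : (mixedBlock J (monomialMatrix π fun _ => 1) ε α V *ᵥ x) i =
        ε * α i * (V *ᵥ x) i := by
      simp only [mulVec, dotProduct, Finset.mul_sum]
      refine Finset.sum_congr rfl fun c _ => ?_
      by_cases hc : J c = ε
      · simp only [mixedBlock, Matrix.of_apply, hc, if_true, max_eq_right hi.le]; ring
      · simp [hx0 c hc]
    rw [h2] at h1
    exact (mul_eq_zero.mp h1).resolve_left hi.ne'
  have hq : ∑ i, α i * ((V *ᵥ x) i * (V *ᵥ x) i) = ∑ c, J c * (x c * x c) := by
    have e1 : x ⬝ᵥ (Vᵀ * diagonal α * V) *ᵥ x = x ⬝ᵥ diagonal J *ᵥ x := by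
      rw [show Vᵀ * diagonal α * V = diagonal J from h]
    rw [← mulVec_mulVec, ← mulVec_mulVec, dotProduct_mulVec, vecMul_transpose] at e1
    simp only [dotProduct, mulVec_diagonal] at e1
    convert e1 using 2 <;> ring
  have hle : ∑ c, x c * x c ≤ 0 := by
    have e2 : ∑ c, x c * x c = ε * ∑ i, α i * ((V *ᵥ x) i * (V *ᵥ x) i) := by
      rw [hq, Finset.mul_sum]
      refine Finset.sum_congr rfl fun c _ => ?_
      by_cases hc : J c = ε
      · rw [hc]; linear_combination (-(x c * x c)) * hεε
      · rw [hx0 c hc]; ring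
    rw [e2, Finset.mul_sum]
    refine Finset.sum_nonpos fun i _ => ?_
    by_cases hi : 0 < ε * α i
    · rw [hVx i hi]; simp
    · rw [← mul_assoc]
      exact mul_nonpos_of_nonpos_of_nonneg (not_lt.mp hi) (mul_self_nonneg _)
  refine hx (funext fun c => ?_)
  have := (Finset.sum_eq_zero_iff_of_nonneg fun c _ => mul_self_nonneg (x c)).mp
    (le_antisymm hle (Finset.sum_nonneg fun c _ => mul_self_nonneg (x c))) c (Finset.mem_univ c)
  exact mul_self_eq_zero.mp this

lemma mixedBlock_monomialMatrix {J : κ → ℝ} (hJ : ∀ c, J c = 1 ∨ J c = -1) {ε : ℝ}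
    (hε : ε = 1 ∨ ε = -1) {σ : κ → ℝ} {π : κ → κ} (hπ : ∀ c, σ (π c) = J c) (a : κ → ℝ) :
    mixedBlock J (monomialMatrix π fun _ => 1) ε σ (monomialMatrix π a) =
      monomialMatrix π (fun _ => 1) * diagonal fun c => if J c = ε then a c else 1 := by
  ext i c
  have hεε : ε * ε = 1 := by rcases hε with h | h <;> simp [h]
  rw [mul_diagonal]
  simp only [mixedBlock, monomialMatrix, Matrix.of_apply]
  by_cases hi : i = π c
  · subst hi
    rw [hπ]
    by_cases hc : J c = ε
    · simp [hc, hεε]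
    · have hopp : J c = -ε := by
        rcases hJ c with h1 | h1 <;> rcases hε with h2 | h2 <;> simp_all
      rw [if_neg hc, if_neg hc, hopp, mul_neg, hεε]
      simp
  · simp [hi]

lemma continuous_mixedBlock_det [Fintype μ] (J : κ → ℝ) (P : Matrix κ κ ℝ) (ε : ℝ)
    (R : Matrix μ κ ℝ) :
    Continuous fun p : (κ → ℝ) × Matrix κ μ ℝ => (mixedBlock J P ε p.1 (p.2 * R)).det := by
  refine Continuous.matrix_det (continuous_matrix fun i c => ?_)
  have h : Continuous fun p : (κ → ℝ) × Matrix κ μ ℝ => (p.2 * R) i c :=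
    (continuous_snd.matrix_mul continuous_const).matrix_elem i c
  simp only [mixedBlock, Matrix.of_apply]
  split_ifs <;> fun_prop

/-- The signs `s` on `T`, extended by `1`. -/
def extendSigns (T : Finset κ) (s : T → ℤˣ) : κ → ℝ :=
  fun c => if h : c ∈ T then ((s ⟨c, h⟩ : ℤ) : ℝ) else 1

omit [Fintype κ] in
lemma extendSigns_sq (T : Finset κ) (s : T → ℤˣ) (c : κ) : extendSigns T s c ^ 2 = 1 := by
  unfold extendSigns
  split_ifs with h
  · rcases Int.units_eq_one_or (s ⟨c, h⟩) with h | h <;> simp [h]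
  · simp

omit [Fintype κ] in
lemma exists_extendSigns_eq {T : Finset κ} {a : κ → ℝ} (ha : ∀ c, a c ^ 2 = 1)
    (ha' : ∀ c, c ∉ T → a c = 1) : ∃ s, extendSigns T s = a := by
  classical
  refine ⟨fun c => if a c = 1 then 1 else -1, funext fun c => ?_⟩
  unfold extendSigns
  split_ifs with h
  · rcases sq_eq_sq_iff_eq_or_eq_neg.mp ((ha c).trans (one_pow 2).symm) with h2 | h2
    · simp [h2]
    · norm_num [h2]
  · exact (ha' c h).symm

/-- `T` picks one column for each sign occurring in `J`. Components are indexed by the set `A` of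
positive weights and a sign for each element of `T`. -/
theorem card_connectedComponents_congrFiber [Fintype μ] {J : κ → ℝ}
    (hJ : ∀ c, J c = 1 ∨ J c = -1) {W₀ : Matrix κ μ ℝ} {R : Matrix μ κ ℝ} (hR : W₀ * R = 1)
    {T : Finset κ} (hT : ∀ c, ∃ t ∈ T, J t = J c) (hTinj : Set.InjOn J T) :
    Nat.card (ConnectedComponents (congrFiber κ (W₀ᵀ * diagonal J * W₀))) =
      (Fintype.card κ).choose {c | 0 < J c}.ncard * 2 ^ T.card := by
  classical
  set p := {c | 0 < J c}.ncard
  choose π hπ using fun A : {A : Finset κ // A.card = p} => exists_perm_signWeights hJ A.2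
  have hmem (A : {A : Finset κ // A.card = p}) (s : T → ℤˣ) :
      (signWeights A.1, monomialMatrix (π A) (extendSigns T s)) ∈ congrFiber κ (diagonal J) := by
    have h := mem_congrFiber_weightsAt (π A).injective J (extendSigns_sq T s)
    have : weightsAt (π A) J = signWeights A.1 := by
      ext i
      obtain ⟨c, rfl⟩ := (π A).surjective i
      rw [weightsAt_apply (π A).injective, hπ]
    rwa [this] at h
  rw [card_connectedComponents_eq (I := {A : Finset κ // A.card = p} × (T → ℤˣ))
    (f := fun i => (signWeights i.1.1, monomialMatrix (π i.1) (extendSigns T i.2) * W₀))]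
  · rw [Nat.card_prod, Nat.card_eq_fintype_card, Nat.card_eq_fintype_card,
      Fintype.card_finset_len]
    simp
  · rintro ⟨A, s⟩
    exact mul_right_mem_congrFiber (hmem A s) W₀
  · rintro ⟨α, W⟩ hW
    obtain ⟨σ, W', hσ, hj⟩ := exists_joinedIn_unit_weights hW
    have hV := mul_rightInverse_mem_congrFiber hR hj.target_mem
    -- At full rank `W' * R` is square and invertible, so `S x = 0` already forces `W' x = 0`.
    have hW' : W' = W' * R * W₀ := by
      refine eq_mul_mul_of_ker_le hR (M := diagonal J) fun x hx => ?_
      rw [← show W'ᵀ * diagonal σ * W' = _ from hj.target_mem] at hx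
      have hdet : (W' * R).det ≠ 0 := by
        intro h0
        have h1 := congrArg det (show (W' * R)ᵀ * diagonal σ * (W' * R) = diagonal J from hV)
        rw [det_mul, h0, mul_zero, det_diagonal] at h1
        exact Finset.prod_ne_zero_iff.mpr
          (fun c _ => by rcases hJ c with h | h <;> simp [h]) h1.symm
      have h2 : (W' * R)ᵀ *ᵥ (diagonal σ *ᵥ W' *ᵥ x) = 0 := by
        rw [← mulVec_zero Rᵀ, ← hx]
        simp only [mulVec_mulVec, transpose_mul, Matrix.mul_assoc]
      have h3 := eq_zero_of_mulVec_eq_zero (by rwa [det_transpose]) h2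
      ext l
      have h4 := congrFun h3 l
      rw [mulVec_diagonal] at h4
      rcases hσ l with h | h <;> simpa [h] using h4
    obtain ⟨-, π', -, -, -, hπ', -, hinj'⟩ := exists_inIdComponent_mul_eq_monomialMatrix hσ hJ hV
    have hA : (Finset.univ.filter fun i => 0 < σ i).card = p := by
      have hp : p = (π' '' {c | 0 < J c}).ncard := (Set.ncard_image_of_injective _ hinj').symm
      rw [← Set.ncard_coe_finset, hp]
      congr 1
      ext i
      obtain ⟨c, rfl⟩ := (Finite.injective_iff_surjective.mp hinj') i
      rw [hinj'.mem_set_image]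
      simp [hπ']
    have hσA : signWeights (Finset.univ.filter fun i => 0 < σ i) = σ := by
      ext i
      unfold signWeights
      rcases hσ i with h | h <;> simp [h]
    obtain ⟨g, a, hg, hmon, ha, ha'⟩ := exists_inIdComponent_mul_eq_monomialMatrix_of_bijective
      hσ hJ hV (π ⟨_, hA⟩).bijective (by simpa only [hσA] using hπ ⟨_, hA⟩) hT hTinj
    obtain ⟨s, rfl⟩ := exists_extendSigns_eq ha ha'
    refine ⟨(⟨_, hA⟩, s), hj.trans ?_⟩
    have h1 := (hg.joinedIn hV).mul_right_congrFiber W₀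
    rw [← hW', hmon] at h1
    simpa only [hσA] using h1
  · rintro C hCF hC ⟨A, s⟩ ⟨B, t⟩ hAs hBt
    have hα (z) (hz : z ∈ C) (i : κ) : z.1 i ≠ 0 :=
      weights_ne_zero_of_mem hJ (mul_rightInverse_mem_congrFiber hR (hCF hz)) i
    have hsign {x y : (κ → ℝ) × Matrix κ μ ℝ} (hx : x ∈ C) (hy : y ∈ C) (i : κ)
        (h : 0 < x.1 i) : 0 < y.1 i :=
      hC.pos_of_pos (f := fun z => z.1 i) (by fun_prop) (fun z hz => hα z hz i) hx hy h
    obtain rfl : A = B := by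
      refine Subtype.ext (Finset.ext fun i => ?_)
      rw [← signWeights_pos_iff, ← signWeights_pos_iff (A := B.1)]
      exact ⟨hsign hAs hBt i, hsign hBt hAs i⟩
    have hpos (z) (hz : z ∈ C) (c : κ) : 0 < z.1 (π A c) * J c := by
      have hAc := hπ A c
      rcases hJ c with h | h
      · rw [h, mul_one]
        exact hsign hAs hz _ (by simp only; rw [hAc, h]; norm_num)
      · rw [h, mul_neg_one, neg_pos]
        refine lt_of_le_of_ne (not_lt.mp fun h' => ?_) (hα z hz _)
        have := hsign hz hAs _ h'
        simp only at this
        rw [hAc, h] at this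
        norm_num at this
    -- Since `T` has a single column of sign `J e`, the determinant sees the sign `s e` and no
    -- other.
    have hval (s : T → ℤˣ) (e : T) :
        (mixedBlock J (monomialMatrix (π A) fun _ => 1) (J e) (signWeights A.1)
          (monomialMatrix (π A) (extendSigns T s) * W₀ * R)).det =
        (monomialMatrix (π A) fun _ => 1).det * ((s e : ℤ) : ℝ) := by
      rw [Matrix.mul_assoc, hR, Matrix.mul_one,
        mixedBlock_monomialMatrix hJ (hJ e) (hπ A), det_mul, det_diagonal,
        Finset.prod_eq_single e.1 (fun c _ hc => ?_) (by simp)]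
      · simp [extendSigns]
      · split_ifs with h
        · have : c ∉ T := fun hcT => hc (hTinj hcT e.2 h)
          simp [extendSigns, this]
        · rfl
    have key (s t : T → ℤˣ) (e : T)
        (hs : (signWeights A.1, monomialMatrix (π A) (extendSigns T s) * W₀) ∈ C)
        (ht : (signWeights A.1, monomialMatrix (π A) (extendSigns T t) * W₀) ∈ C)
        (h : 0 < (monomialMatrix (π A) fun _ => 1).det * ((s e : ℤ) : ℝ)) :
        0 < (monomialMatrix (π A) fun _ => 1).det * ((t e : ℤ) : ℝ) := by
      rw [← hval] at h ⊢
      exact hC.pos_of_pos (continuous_mixedBlock_det J _ (J e) R).continuousOn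
        (fun z hz => mixedBlock_det_ne_zero hJ (hJ e)
          (mul_rightInverse_mem_congrFiber hR (hCF hz)) (hpos z hz)) hs ht h
    have hdet (e : T) : (monomialMatrix (π A) fun _ => 1).det * ((s e : ℤ) : ℝ) ≠ 0 := by
      rw [← hval]
      exact mixedBlock_det_ne_zero hJ (hJ e)
          (mul_rightInverse_mem_congrFiber hR (hCF hAs)) (hpos _ hAs)
    have hst : s = t := by
      funext e
      have h0 := hdet e
      have h1 := key s t e hAs hBt
      have h2 := key t s e hBt hAs
      by_contra hne
      rw [Int.units_ne_iff_eq_neg.mp hne] at h0 h1 h2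
      push_cast at h0 h1 h2
      rcases lt_or_gt_of_ne h0 with h | h
      · linarith [h2 (by linarith)]
      · linarith [h1 h]
    rw [hst]

end Counting

/-! ### Assembly of the four cases -/

theorem theoremB1 (n r : ℕ) (S : Matrix (Fin n) (Fin n) ℝ) (hS : S.IsSymm)
    (sp sm s0 : ℕ) (hsig : HasSignature S sp sm s0) :
    (r < S.rank → quadFiber r S = ∅) ∧
    (S.rank = r → 0 < r → (sp = 0 ∨ sm = 0) →
      Nat.card (ConnectedComponents (quadFiber r S)) = 2) ∧
    (S.rank = r → 0 < sp → 0 < sm →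
      Nat.card (ConnectedComponents (quadFiber r S)) = 4 * r.choose sp ∧
      4 * r.choose sp = 4 * r.choose sm) ∧
    (S.rank < r → IsConnected (quadFiber r S)) := by
  obtain ⟨hsp, hsm, -⟩ := hsig
  obtain ⟨J, W₀, R, hJ, hW₀, hR, hpos, hneg⟩ := exists_signed_diagonalization S hS
  rw [hsp] at hpos
  rw [hsm] at hneg
  have hsum : sp + sm = S.rank := by
    have h : {c | J c < 0} = {c | 0 < J c}ᶜ := by
      ext c
      rcases hJ c with h | h <;> norm_num [h]
    rw [← hpos, ← hneg, h, Set.ncard_add_ncard_compl, Nat.card_eq_fintype_card, Fintype.card_fin]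
  have hfiber (r : ℕ) : quadFiber r S =
      congrFiber (Fin r) (W₀.transpose * Matrix.diagonal J * W₀) := by
    rw [hW₀]; rfl
  have hcount {T : Finset (Fin S.rank)} (hT : ∀ c, ∃ t ∈ T, J t = J c) (hTi : Set.InjOn J T) :
      Nat.card (ConnectedComponents (quadFiber S.rank S)) =
        S.rank.choose sp * 2 ^ T.card := by
    have h := card_connectedComponents_congrFiber hJ hR hT hTi
    rw [hpos, Fintype.card_fin] at h
    rw [← h, hfiber]
  have hex {c : Fin S.rank → Prop} {k : ℕ} (hk : {x | c x}.ncard = k) (h0 : 0 < k) : ∃ x, c x :=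
    Set.nonempty_of_ncard_ne_zero (hk ▸ h0.ne')
  refine ⟨fun hr => ?_, ?_, ?_, fun hr => ?_⟩
  · refine Set.eq_empty_of_forall_notMem fun p hp => hr.not_ge ?_
    rw [← show quadTau r n p = S from hp]
    exact (Matrix.rank_mul_le_right _ _).trans (Matrix.rank_le_height _)
  · rintro rfl hr hdef
    have hconst (c d : Fin S.rank) : J c = J d := by
      rcases hdef with h | h
      · have hnp (c) : ¬ 0 < J c := fun hc => by
          rw [h, Set.ncard_eq_zero] at hpos
          exact hpos.subset hc
        rw [(hJ c).resolve_left fun h => hnp c (by rw [h]; norm_num),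
          (hJ d).resolve_left fun h => hnp d (by rw [h]; norm_num)]
      · have hnn (c) : ¬ J c < 0 := fun hc => by
          rw [h, Set.ncard_eq_zero] at hneg
          exact hneg.subset hc
        rw [(hJ c).resolve_right fun h => hnn c (by rw [h]; norm_num),
          (hJ d).resolve_right fun h => hnn d (by rw [h]; norm_num)]
    -- In the definite case `J` is constant, so one column represents it and the binomial
    -- coefficient is 1.
    rw [hcount (T := {⟨0, hr⟩}) (fun c => ⟨_, Finset.mem_singleton_self _, hconst _ _⟩) (by simp)]
    rcases hdef with h | h
    · simp [h]
    · rw [h, add_zero] at hsum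
      simp [hsum]
  · rintro rfl h1 h2
    obtain ⟨x, hx⟩ := hex hpos h1
    obtain ⟨y, hy⟩ := hex hneg h2
    have hx1 : J x = 1 := (hJ x).resolve_right fun h => by rw [h] at hx; norm_num at hx
    have hy1 : J y = -1 := (hJ y).resolve_left fun h => by rw [h] at hy; norm_num at hy
    have hxy : x ≠ y := by rintro rfl; linarith
    refine ⟨?_, ?_⟩
    · rw [hcount (T := {x, y}) (fun c => ?_) ?_, Finset.card_pair hxy]
      · ring
      · rw [Finset.coe_pair, Set.injOn_pair]
        intro h
        linarith
      · rcases hJ c with h | h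
        · exact ⟨x, by simp, by rw [hx1, h]⟩
        · exact ⟨y, by simp, by rw [hy1, h]⟩
    · rw [← hsum, Nat.choose_symm_add]
  · rw [hfiber]
    exact isConnected_congrFiber_of_card_lt (by simpa using hr) hJ hR
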